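/- Let $a\in\mathbb R$, $b>0$. For $\alpha\in\mathbb R$ consider $$\dot x_2=y\bigl((1+\alpha y)+x_2(x_2-q_2)\bigr),\qquad \dot y=y^2(x_2-q_2),\qquad \dot q_2=q_2(x_2-q_2)\Bigl(b+\frac{ay^2}{1+ay}\Bigr). \tag{1}$$ For $\xi,\chi,\mu>0$ with $1+a\chi>0$ and $\varepsilon>0$ put $$U_2=\{(x_2,y,q_2)\mid |x_2|\le\xi^{-1},\ 0\le y\le\chi,\ 0\le q_2\le\mu^{-1}\},\qquad \Gamma_2=\{(x_2,y,q_2)\in U_2\mid q_2=\mu^{-1}\},$$ $$Q_2=\{(x_2,y,q_2)\mid \sqrt\varepsilon\,q_2=(1+ay)e^{-b/y}\},$$ where $e^{-b/y}$ is read as $0$ at $y=0$. Let $\widehat U_2\supset U_2$ and $\widehat\Gamma_2\supset\Gamma_2$ be the sets obtained by dropping the condition $|x_2|\le\xi^{-1}$. For every $\nu>0$ there is $\mu_0>0$ such that for all $\mu\ge\mu_0$, all $\xi,\chi>0$ with $1+a\chi>0$, and all $A$, there is $\varepsilon_0>0$ such that the following holds. 1. For $0<\varepsilon<\varepsilon_0$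 there is a number $y_\varepsilon$ with $\Gamma_2\cap Q_2=\{(x_2,y_\varepsilon,\mu^{-1})\mid |x_2|\le\xi^{-1}\}$, so that $x_2$ is a coordinate on $\Gamma_2\cap Q_2$. 2. For $0<\varepsilon<\varepsilon_0$, $|\alpha|\le A$ and every $x_2\in[-\xi^{-1},-\nu]$, the forward orbit of (1) through $(x_2,y_\varepsilon,\mu^{-1})$ returns to $\widehat\Gamma_2\cap Q_2$, staying in $\widehat U_2$ until it does so; its first return point is $(x_2^+(x_2),y_\varepsilon,\mu^{-1})$, and the first return map $x_2\mapsto x_2^+(x_2)$ is differentiable on $[-\xi^{-1},-\nu]$. 3. As $\varepsilon\to0$, $$x_2^+(x_2)=-x_2+o(1),\qquad (x_2^+)'(x_2)=-1+o(1),$$ uniformly in $x_2\in[-\xi^{-1},-\nu]$ and $|\alpha|\le A$. Moreover, for every $\delta>0$ and all sufficiently small $\varepsilon$, for all $x_2\in[-\xi^{-1}+\delta,-\nu]$ and $|\alpha|\le A$ the orbit stays in $U_2$ up to its first return and the return point lies in $\Gamma_2\cap Q_2$, so that $x_2^+$ is the first return map to $\Gamma_2\cap Q_2$ there. -/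

import Mathlib

open Set

noncomputable section

/-- The vector field of the aircraft model in the scaling chart, in the coordinates
`p = (x₂, y, q₂)`. It is a genuine vector field where `1 + a * y ≠ 0`. -/
def scalingField (a b α : ℝ) (p : ℝ × ℝ × ℝ) : ℝ × ℝ × ℝ :=
  (p.2.1 * ((1 + α * p.2.1) + p.1 * (p.1 - p.2.2)),
   p.2.1 ^ 2 * (p.1 - p.2.2),
   p.2.2 * (p.1 - p.2.2) * (b + a * p.2.1 ^ 2 / (1 + a * p.2.1)))

/-- The flat function `y ↦ (1 + a y) e^{-b / y}` on `y ≥ 0`, with its limit value `0` at `y = 0`. -/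
def flatFun (a b y : ℝ) : ℝ :=
  if y = 0 then 0 else (1 + a * y) * Real.exp (-(y⁻¹ * b))

/-- The set `Q₂`, which carries the small parameter `ε`. -/
def Q₂ (a b ε : ℝ) : Set (ℝ × ℝ × ℝ) :=
  {p | Real.sqrt ε * p.2.2 = flatFun a b p.2.1}

/-- The box `U₂`. -/
def U₂ (ξ χ μ : ℝ) : Set (ℝ × ℝ × ℝ) :=
  {p | p.1 ∈ Icc (-ξ⁻¹) ξ⁻¹ ∧ p.2.1 ∈ Icc 0 χ ∧ p.2.2 ∈ Icc 0 μ⁻¹}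

/-- The face `Γ₂` of the box `U₂` with `q₂ = μ⁻¹`. -/
def Γ₂ (ξ χ μ : ℝ) : Set (ℝ × ℝ × ℝ) :=
  {p | p ∈ U₂ ξ χ μ ∧ p.2.2 = μ⁻¹}

/-- The slab obtained from the box `U₂` by dropping the bound on `x₂`. -/
def slab (χ μ : ℝ) : Set (ℝ × ℝ × ℝ) :=
  {p | p.2.1 ∈ Icc 0 χ ∧ p.2.2 ∈ Icc 0 μ⁻¹}

/-- The face of the slab with `q₂ = μ⁻¹`: this is `Γ₂` without the bound on `x₂`. -/
def slabFace (χ μ : ℝ) : Set (ℝ × ℝ × ℝ) :=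
  {p | p ∈ slab χ μ ∧ p.2.2 = μ⁻¹}

/-- The forward orbit under `V` of the point `p` of `S` stays in `W` until it meets `S` again, and
the first point of `S` that it meets is `p'`. -/
def IsFirstReturn (V : ℝ × ℝ × ℝ → ℝ × ℝ × ℝ) (W S : Set (ℝ × ℝ × ℝ)) (p p' : ℝ × ℝ × ℝ) : Prop :=
  p ∈ S ∧ p' ∈ S ∧ ∃ T : ℝ, 0 < T ∧ ∃ γ : ℝ → ℝ × ℝ × ℝ, γ 0 = p ∧ γ T = p' ∧
    (∀ t ∈ Icc 0 T, γ t ∈ W ∧ HasDerivWithinAt γ (V (γ t)) (Icc 0 T) t) ∧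
    ∀ t ∈ Ioo 0 T, γ t ∉ S

end

open MeasureTheory intervalIntegral Filter Topology

/-! Along (1) the ratio of `q₂` to `(1 + a y) e^{-b/y}` is constant, so `Q₂` is invariant. On it put
`η = y_ε`, `z = η / y`, `ω = x₂ z`. The terms in `x₂ - q₂` cancel in the derivative of `ω`, leaving
`η (1 + α y) > 0`, so `ω` can replace time. With `k = α η` and `r = (z² - 1) / 2 + k (z - 1)` the
orbit solves the scalar equation `dr/dω = G(r) - ω`, where `G` is `z q₂` as a function of `r`. The
orbit lies on the face `q₂ = μ⁻¹` exactly when `r = 0`: it leaves at `ω = x` and returns at `ω =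
P(x)`, and there `ω = x₂`.

As `ε → 0` also `η → 0`, and `G` and `g = G'` become at most `σ` on `r ≥ σ` for any prescribed small
`σ`. Hence `r` is close to `(x² - ω²) / 2` and `P(x)` to `-x`. Near `r = 0` only `G ≤ 3ν/4` is
available; this needs `μ` large and makes the crossing at `ω ≥ ν` transversal
(`IsArc.exists_return`, `IsArc.return_sub_le`).

Comparing two solutions gives `P' = (G 0 - x) / (G 0 - P) * exp (∫ g(r) dω)`
(`hasDerivWithinAt_return`). The integral need not be small, since `g` is large near `r = 0`. But `g
= (log |G - ω|)' + 1 / (G - ω)` along a solution, and `1 / (G - ω)` is `-1 / ω` up to a multiple of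
`G`. The logarithms cancel the prefactor, and `∫ G`, the gain of the energy `r + ω² / 2`, is `O(σ)`
(`IsArc.abs_log_deriv_le`). -/

/-! ### Calculus inequalities and solvability of the scalar equation -/

theorem hasDerivAt_primitive {f : ℝ → ℝ} (hf : Continuous f) (a t : ℝ) :
    HasDerivAt (fun u => ∫ s in a..u, f s) (f t) t :=
  integral_hasDerivAt_right (hf.intervalIntegrable _ _) (hf.stronglyMeasurableAtFilter _ _)
    hf.continuousAt

theorem sub_le_of_hasDerivAt_le {f f' : ℝ → ℝ} {s t C : ℝ} (hst : s ≤ t)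
    (hf : ∀ ω ∈ Icc s t, HasDerivAt f (f' ω) ω) (hC : ∀ ω ∈ Icc s t, f' ω ≤ C) :
    f t - f s ≤ C * (t - s) :=
  (convex_Icc s t).image_sub_le_mul_sub_of_deriv_le
    (fun ω hω => (hf ω hω).continuousAt.continuousWithinAt)
    (fun ω hω => (hf ω (interior_subset hω)).differentiableAt.differentiableWithinAt)
    (fun ω hω => by
      rw [(hf ω (interior_subset hω)).deriv]; exact hC ω (interior_subset hω))
    s (left_mem_Icc.2 hst) t (right_mem_Icc.2 hst) hst

theorem abs_sub_le_of_abs_deriv_le {f f' h h' : ℝ → ℝ} {s t : ℝ} (hst : s ≤ t)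
    (hf : ∀ ω ∈ Icc s t, HasDerivAt f (f' ω) ω) (hh : ∀ ω ∈ Icc s t, HasDerivAt h (h' ω) ω)
    (hle : ∀ ω ∈ Icc s t, |f' ω| ≤ h' ω) : |f t - f s| ≤ h t - h s := by
  have h1 := sub_le_of_hasDerivAt_le (C := 0) hst (fun ω hω => (hf ω hω).sub (hh ω hω))
    fun ω hω => by linarith [le_abs_self (f' ω), hle ω hω]
  have h2 := sub_le_of_hasDerivAt_le (C := 0) hst (fun ω hω => (hf ω hω).neg.sub (hh ω hω))
    fun ω hω => by linarith [neg_abs_le (f' ω), hle ω hω]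
  simp only [Pi.sub_apply, Pi.neg_apply] at h1 h2
  rw [abs_le]
  constructor <;> linarith

/-- A scalar equation `r' = G r - ω` with `G` bounded and Lipschitz is solvable on any compact
interval; the solution is extended to a continuous function on the line. -/
theorem exists_solution {G : ℝ → ℝ} {K : NNReal} (hG : LipschitzWith K G) {B : ℝ}
    (h0 : ∀ r, 0 ≤ G r) (hB : ∀ r, G r ≤ B) {M x : ℝ} (hx : x ∈ Icc (-M) M) :
    ∃ r : ℝ → ℝ, Continuous r ∧ r x = 0 ∧
      ∀ ω ∈ Icc (-M) M, HasDerivAt r (G (r ω) - ω) ω := by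
  have hM : 0 ≤ M := by linarith [hx.1, hx.2]
  have hB0 : 0 ≤ B := (h0 0).trans (hB 0)
  have hP : IsPicardLindelof (fun ω r => G r - ω) (⟨x, hx⟩ : Icc (-M) M) (0 : ℝ)
      (Real.toNNReal ((B + M) * (2 * M))) 0 (Real.toNNReal (B + M)) K := by
    refine ⟨fun t _ => ?_, fun r _ => by fun_prop, fun t ht r _ => ?_, ?_⟩
    · refine LipschitzWith.lipschitzOnWith (LipschitzWith.of_dist_le_mul fun u v => ?_)
      simpa [Real.dist_eq] using hG.dist_le_mul u v
    · rw [Real.coe_toNNReal _ (by positivity), Real.norm_eq_abs, abs_le]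
      constructor <;> linarith [h0 r, hB r, ht.1, ht.2]
    · rw [Real.coe_toNNReal _ (by positivity), Real.coe_toNNReal _ (by positivity)]
      simp only [NNReal.coe_zero, sub_zero]
      refine mul_le_mul_of_nonneg_left (max_le ?_ ?_) (by positivity) <;>
        linarith [hx.1, hx.2]
  obtain ⟨β, hβx, hβ⟩ := hP.exists_eq_forall_mem_Icc_hasDerivWithinAt₀
  have hβc : ContinuousOn β (Icc (-M) M) := fun t ht => (hβ t ht).continuousWithinAt
  have hMM : -M ≤ M := by linarith
  -- Integrating the constant extension of `β` gives a function on the whole line with two-sided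
  -- derivatives even at `±M`.
  set β' : ℝ → ℝ := IccExtend hMM ((Icc (-M) M).domRestrict β) with hβ'
  have hβ'c : Continuous β' := hβc.domRestrict.Icc_extend'
  have hGc : Continuous G := hG.continuous
  have hcont : Continuous fun s => G (β' s) - s := by fun_prop
  have hβ'e : ∀ t ∈ Icc (-M) M, β' t = β t := fun t ht => by
    rw [hβ', IccExtend_of_mem hMM _ ht, domRestrict_apply]
  have hd : ∀ t, HasDerivAt (fun ω => ∫ s in x..ω, (G (β' s) - s)) (G (β' t) - t) t := 
    hasDerivAt_primitive hcont x
  have he : ∀ t ∈ Icc (-M) M, ∫ s in x..t, (G (β' s) - s) = β t := by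
    intro t ht
    have hsub : uIcc x t ⊆ Icc (-M) M := uIcc_subset_Icc hx ht
    have := integral_eq_sub_of_hasDeriv_right (a := x) (b := t) (f := β)
      (f' := fun s => G (β' s) - s) (hβc.mono hsub) (fun s hs => ?_) (hcont.intervalIntegrable _ _)
    · rw [this]; simp only at hβx; rw [hβx]; simp
    · have hs' : s ∈ Ioo (-M) M := by
        have h1 : -M ≤ min x t := le_min hx.1 ht.1
        have h2 : max x t ≤ M := max_le hx.2 ht.2
        exact ⟨h1.trans_lt hs.1, hs.2.trans_le h2⟩
      have h := hβ s (Ioo_subset_Icc_self hs')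
      rw [hβ'e s (Ioo_subset_Icc_self hs')]
      exact (h.hasDerivAt (Icc_mem_nhds hs'.1 hs'.2)).hasDerivWithinAt
  refine ⟨fun ω => ∫ s in x..ω, (G (β' s) - s),
    continuous_iff_continuousAt.2 fun t => (hd t).continuousAt, by simp, fun ω hω => ?_⟩
  have := hd ω
  rw [hβ'e ω hω] at this
  simpa only [he ω hω] using this

/-! ### Exact comparison of two solutions -/

/-- The difference quotient of a primitive of `g`, as a mean of `g`. -/
noncomputable def meanSlope (g : ℝ → ℝ) (u v : ℝ) : ℝ := ∫ t in (0 : ℝ)..1, g (u + t * (v - u))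

theorem continuous_meanSlope {g : ℝ → ℝ} (hg : Continuous g) :
    Continuous fun p : ℝ × ℝ => meanSlope g p.1 p.2 := by
  unfold meanSlope
  refine continuous_parametric_intervalIntegral_of_continuous' (f := fun (p : ℝ × ℝ) t =>
    g (p.1 + t * (p.2 - p.1))) ?_ 0 1
  fun_prop

theorem meanSlope_self (g : ℝ → ℝ) (u : ℝ) : meanSlope g u u = g u := by
  simp [meanSlope]

theorem abs_meanSlope_le {g : ℝ → ℝ} {L : ℝ} (hL : ∀ r, |g r| ≤ L) (u v : ℝ) :
    |meanSlope g u v| ≤ L := by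
  have := norm_integral_le_of_norm_le_const (a := (0 : ℝ)) (b := 1)
    (f := fun t => g (u + t * (v - u))) (C := L) fun t _ => hL _
  simpa [meanSlope] using this

theorem meanSlope_mul {G g : ℝ → ℝ} (hG : ∀ r, HasDerivAt G (g r) r) (hg : Continuous g)
    (u v : ℝ) : meanSlope g u v * (v - u) = G v - G u := by
  have h : ∀ t ∈ uIcc (0 : ℝ) 1, HasDerivAt (fun t => G (u + t * (v - u)))
      (g (u + t * (v - u)) * (v - u)) t := fun t _ => by
    have h1 : HasDerivAt (fun t : ℝ => u + t * (v - u)) (v - u) t := by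
      simpa using ((hasDerivAt_id t).mul_const (v - u)).const_add u
    exact (hG _).comp t h1
  have := integral_eq_sub_of_hasDerivAt h (Continuous.intervalIntegrable (by fun_prop) _ _)
  rw [intervalIntegral.integral_mul_const] at this
  rw [meanSlope, this]
  simp

/-- The difference solves a linear equation whose coefficient is the mean slope of `G`. Being an
identity and not a Grönwall bound, it yields the exact derivative of the return map. -/
theorem solution_sub_eq {G g : ℝ → ℝ} (hG : ∀ r, HasDerivAt G (g r) r) (hg : Continuous g)
    {M : ℝ} {r₁ r₂ : ℝ → ℝ} (hc₁ : Continuous r₁) (hc₂ : Continuous r₂)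
    (h₁ : ∀ ω ∈ Icc (-M) M, HasDerivAt r₁ (G (r₁ ω) - ω) ω)
    (h₂ : ∀ ω ∈ Icc (-M) M, HasDerivAt r₂ (G (r₂ ω) - ω) ω)
    {s t : ℝ} (hs : s ∈ Icc (-M) M) (ht : t ∈ Icc (-M) M) :
    r₁ t - r₂ t = (r₁ s - r₂ s) * Real.exp (∫ ω in s..t, meanSlope g (r₂ ω) (r₁ ω)) := by
  have hk : Continuous fun ω => meanSlope g (r₂ ω) (r₁ ω) :=
    (continuous_meanSlope hg).comp (hc₂.prodMk hc₁)
  have hE : ∀ ω, HasDerivAt (fun ω => ∫ u in s..ω, meanSlope g (r₂ u) (r₁ u))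
      (meanSlope g (r₂ ω) (r₁ ω)) ω := 
    hasDerivAt_primitive hk s
  set E := fun ω => ∫ u in s..ω, meanSlope g (r₂ u) (r₁ u) with hEdef
  have hd : ∀ ω ∈ Icc (-M) M,
      HasDerivWithinAt (fun ω => (r₁ ω - r₂ ω) * Real.exp (-E ω)) 0 (Icc (-M) M) ω := by
    intro ω hω
    have := (((h₁ ω hω).sub (h₂ ω hω)).mul (hE ω).neg.exp).hasDerivWithinAt (s := Icc (-M) M)
    refine this.congr_deriv ?_
    have hm := meanSlope_mul hG hg (r₂ ω) (r₁ ω)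
    simp only [Pi.sub_apply, Pi.neg_apply]
    linear_combination (-Real.exp (-E ω)) * hm
  have hconst := (convex_Icc (-M) M).norm_image_sub_le_of_norm_hasDerivWithin_le
    (C := 0) hd (by simp) hs ht
  simp only [zero_mul, norm_le_zero_iff, sub_eq_zero] at hconst
  have hEs : E s = 0 := by simp [hEdef]
  rw [hEs, neg_zero, Real.exp_zero, mul_one] at hconst
  rw [← hconst, mul_assoc, ← Real.exp_add]
  simp [hEdef]

/-! ### Forcings, arcs and existence of the return -/

/-- `G` is a nonnegative function bounded by `3 ν / 4`, with bounded continuous derivative `g`. -/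
structure IsForcing (G g : ℝ → ℝ) (L ν : ℝ) : Prop where
  hasDerivAt : ∀ r, HasDerivAt G (g r) r
  continuous : Continuous g
  abs_le : ∀ r, |g r| ≤ L
  nonneg : ∀ r, 0 ≤ G r
  le : ∀ r, G r ≤ 3 * ν / 4

/-- `r` solves `r' = G r - ω` on `[-M, M]` and vanishes at `x`. -/
structure IsArc (G : ℝ → ℝ) (M x : ℝ) (r : ℝ → ℝ) : Prop where
  continuous : Continuous r
  init : r x = 0
  hasDerivAt : ∀ ω ∈ Icc (-M) M, HasDerivAt r (G (r ω) - ω) ω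

theorem IsForcing.exists_isArc {G g : ℝ → ℝ} {L ν : ℝ} (hG : IsForcing G g L ν) {M x : ℝ}
    (hx : x ∈ Icc (-M) M) : ∃ r, IsArc G M x r := by
  have hL : 0 ≤ L := (abs_nonneg _).trans (hG.abs_le 0)
  have hlip : LipschitzWith (Real.toNNReal L) G :=
    lipschitzWith_of_nnnorm_deriv_le (fun r => (hG.hasDerivAt r).differentiableAt) fun r => by
      rw [(hG.hasDerivAt r).deriv, ← NNReal.coe_le_coe, Real.coe_toNNReal _ hL]
      exact hG.abs_le r
  obtain ⟨r, h1, h2, h3⟩ := exists_solution hlip hG.nonneg hG.le hx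
  exact ⟨r, h1, h2, h3⟩

section Arc

variable {G g : ℝ → ℝ} {L ν M x : ℝ} {r : ℝ → ℝ}

/-- The energy `r + ω² / 2` is conserved without forcing. As `G ≥ 0` it grows, which keeps arcs
above the parabola `(x² - ω²) / 2`. -/
theorem IsArc.hasDerivAt_energy (hr : IsArc G M x r) {ω : ℝ} (hω : ω ∈ Icc (-M) M) :
    HasDerivAt (fun ω => r ω + ω ^ 2 / 2) (G (r ω)) ω := by
  refine ((hr.hasDerivAt ω hω).add (((hasDerivAt_id ω).pow 2).div_const 2)).congr_deriv ?_
  simp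

theorem IsArc.energy_sub_le (hr : IsArc G M x r) {s t C : ℝ} (hs : -M ≤ s) (hst : s ≤ t)
    (ht : t ≤ M) (hC : ∀ ω ∈ Icc s t, G (r ω) ≤ C) :
    r t + t ^ 2 / 2 - (r s + s ^ 2 / 2) ≤ C * (t - s) :=
  sub_le_of_hasDerivAt_le (f := fun ω => r ω + ω ^ 2 / 2) hst
    (fun _ hω => hr.hasDerivAt_energy ⟨hs.trans hω.1, hω.2.trans ht⟩) hC

theorem IsArc.energy_mono (hG : IsForcing G g L ν) (hr : IsArc G M x r) {s t : ℝ} (hs : -M ≤ s)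
    (hst : s ≤ t) (ht : t ≤ M) : r s + s ^ 2 / 2 ≤ r t + t ^ 2 / 2 := by
  have := sub_le_of_hasDerivAt_le (f := fun ω => -(r ω + ω ^ 2 / 2)) (C := 0) hst
    (fun ω hω => (hr.hasDerivAt_energy ⟨hs.trans hω.1, hω.2.trans ht⟩).neg)
    (fun ω _ => by linarith [hG.nonneg (r ω)])
  linarith

theorem IsArc.le_apply (hG : IsForcing G g L ν) (hr : IsArc G M x r) {ω : ℝ} (hx : -M ≤ x)
    (hxω : x ≤ ω) (hω : ω ≤ M) : (x ^ 2 - ω ^ 2) / 2 ≤ r ω := by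
  have := hr.energy_mono hG hx hxω hω
  rw [hr.init] at this
  linarith

theorem IsArc.sub_le (hG : IsForcing G g L ν) (hν : 0 < ν) (hr : IsArc G M x r) {s t : ℝ}
    (hs : ν ≤ s) (hst : s ≤ t) (ht : t ≤ M) : r t - r s ≤ -(ν / 4) * (t - s) :=
  sub_le_of_hasDerivAt_le hst (fun ω hω => hr.hasDerivAt ω ⟨by linarith [hω.1], by linarith [hω.2]⟩)
    fun ω hω => by linarith [hG.le (r ω), hω.1]

theorem IsArc.abs_sub_le (hG : IsForcing G g L ν) (hν : 0 < ν) (hr : IsArc G M x r) {s t : ℝ}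
    (hs : s ∈ Icc ν M) (ht : t ∈ Icc ν M) : |t - s| ≤ 4 / ν * |r t - r s| := by
  have key : ∀ {s t : ℝ}, s ∈ Icc ν M → t ∈ Icc ν M → s ≤ t → |t - s| ≤ 4 / ν * |r t - r s| := by
    intro s t hs ht hst
    have h := hr.sub_le hG hν hs.1 hst ht.2
    rw [abs_of_nonneg (sub_nonneg.2 hst), div_mul_eq_mul_div, le_div_iff₀ hν]
    linarith [neg_abs_le (r t - r s)]
  rcases le_total s t with h | h
  · exact key hs ht h
  · rw [abs_sub_comm t s, abs_sub_comm (r t)]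
    exact key ht hs h

/-- At `-x` the arc has height at most `3ν/4 * 2|x|`. Beyond it the slope is at most `3ν/4 - ν =
-ν/4`, so a further length `6|x|` suffices; hence the factor `7`. -/
theorem IsArc.exists_return (hG : IsForcing G g L ν) (hν : 0 < ν) (hr : IsArc G M x r)
    (hx : x ≤ -ν) (hM : -(7 * x) ≤ M) :
    ∃ P, -x ≤ P ∧ P ≤ -(7 * x) ∧ r P = 0 ∧ ∀ ω ∈ Ioo x P, 0 < r ω := by
  have hlow : 0 ≤ r (-x) := by
    have := hr.le_apply hG (ω := -x) (by linarith) (by linarith) (by linarith)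
    nlinarith
  have hup : r (-x) ≤ 3 * ν / 4 * (-x - x) := by
    have := hr.energy_sub_le (s := x) (t := -x) (C := 3 * ν / 4) (by linarith) (by linarith)
      (by linarith) fun ω _ => hG.le _
    rw [hr.init] at this
    linarith [neg_sq x]
  have hend : r (-(7 * x)) ≤ 0 := by
    have := hr.sub_le hG hν (s := -x) (t := -(7 * x)) (by linarith) (by linarith) (by linarith)
    linarith
  obtain ⟨P, hP, hP0⟩ := intermediate_value_Icc' (show -x ≤ -(7 * x) by linarith)
    hr.continuous.continuousOn ⟨hend, hlow⟩
  refine ⟨P, hP.1, hP.2, hP0, fun ω hω => ?_⟩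
  rcases lt_or_ge ω (-x) with h | h
  · have := hr.le_apply hG (ω := ω) (by linarith) hω.1.le (by linarith)
    nlinarith [mul_pos (sub_pos.2 hω.1) (show 0 < -x - ω by linarith)]
  · have := hr.sub_le hG hν (s := ω) (t := P) (by linarith) hω.2.le (by linarith [hP.2])
    nlinarith [mul_pos hν (sub_pos.2 hω.2)]

end Arc

/-! ### Differentiability of the return map -/

theorem abs_integral_meanSlope_le {g : ℝ → ℝ} {L : ℝ} (hL : ∀ r, |g r| ≤ L) (r₁ r₂ : ℝ → ℝ)
    (s t : ℝ) : |∫ ω in s..t, meanSlope g (r₂ ω) (r₁ ω)| ≤ L * |t - s| := by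
  rw [← Real.norm_eq_abs]
  exact norm_integral_le_of_norm_le_const fun _ _ => abs_meanSlope_le hL _ _

/-- The first return of the arcs starting on `S` depends differentiably on the starting point. -/
theorem hasDerivWithinAt_return {G g : ℝ → ℝ} {L ν M : ℝ} (hG : IsForcing G g L ν) (hν : 0 < ν)
    {S : Set ℝ} (hS : S ⊆ Icc (-M) (-ν)) {R : ℝ → ℝ → ℝ} {P : ℝ → ℝ}
    (hR : ∀ x ∈ S, IsArc G M x (R x)) (hP : ∀ x ∈ S, P x ∈ Icc ν M)
    (hRP : ∀ x ∈ S, R x (P x) = 0) {x : ℝ} (hx : x ∈ S) :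
    HasDerivWithinAt P ((G 0 - x) / (G 0 - P x) * Real.exp (∫ ω in x..P x, g (R x ω))) S x := by
  have hL : 0 ≤ L := (abs_nonneg _).trans (hG.abs_le 0)
  have hSM : ∀ {y}, y ∈ S → y ∈ Icc (-M) M := fun {y} hy =>
    ⟨(hS hy).1, by linarith [(hS hy).1, (hS hy).2]⟩
  have hPM : ∀ {y}, y ∈ S → P y ∈ Icc (-M) M := fun {y} hy =>
    ⟨by linarith [(hP y hy).1, (hP y hy).2], (hP y hy).2⟩
  have hdiff : ∀ y ∈ S, ∀ t ∈ Icc (-M) M, R x t - R y t =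
      R x y * Real.exp (∫ ω in y..t, meanSlope g (R y ω) (R x ω)) := by
    intro y hy t ht
    have := solution_sub_eq hG.hasDerivAt hG.continuous (hR x hx).continuous (hR y hy).continuous
      (hR x hx).hasDerivAt (hR y hy).hasDerivAt (hSM hy) ht
    rwa [(hR y hy).init, sub_zero] at this
  have hbound : ∀ y ∈ S, ∀ t ∈ Icc (-M) M,
      |R x t - R y t| ≤ |R x y| * Real.exp (L * (2 * M)) := by
    intro y hy t ht
    rw [hdiff y hy t ht, abs_mul, Real.abs_exp]
    refine mul_le_mul_of_nonneg_left (Real.exp_le_exp.2 ?_) (abs_nonneg _)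
    refine (le_abs_self _).trans ((abs_integral_meanSlope_le hG.abs_le _ _ _ _).trans ?_)
    refine mul_le_mul_of_nonneg_left ?_ hL
    rw [abs_le]
    constructor <;> linarith [ht.1, ht.2, (hSM hy).1, (hSM hy).2]
  have hself : ∀ᶠ y in 𝓝[S] x, y ∈ S := self_mem_nhdsWithin
  have hRx : Tendsto (fun y => |R x y| * Real.exp (L * (2 * M))) (𝓝[S] x) (𝓝 0) := by
    have : Continuous fun y => |R x y| * Real.exp (L * (2 * M)) := by
      have := (hR x hx).continuous
      fun_prop
    simpa [(hR x hx).init] using (this.tendsto x).mono_left nhdsWithin_le_nhds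
  have hRt : ∀ t ∈ Icc (-M) M, Tendsto (fun y => R y t) (𝓝[S] x) (𝓝 (R x t)) := by
    intro t ht
    rw [tendsto_iff_dist_tendsto_zero]
    refine squeeze_zero' (Eventually.of_forall fun _ => dist_nonneg) ?_ hRx
    filter_upwards [hself] with y hy
    rw [dist_comm]
    exact hbound y hy t ht
  have hPx : Tendsto P (𝓝[S] x) (𝓝 (P x)) := by
    rw [tendsto_iff_dist_tendsto_zero]
    have : Tendsto (fun y => 4 / ν * (|R x y| * Real.exp (L * (2 * M)))) (𝓝[S] x) (𝓝 0) := by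
      simpa using hRx.const_mul (4 / ν)
    refine squeeze_zero' (Eventually.of_forall fun _ => dist_nonneg) ?_ this
    filter_upwards [hself] with y hy
    rw [Real.dist_eq]
    refine ((hR x hx).abs_sub_le hG hν (hP x hx) (hP y hy)).trans ?_
    refine mul_le_mul_of_nonneg_left ?_ (by positivity)
    have := hbound y hy (P y) (hPM hy)
    rwa [hRP y hy, ← hRP x hx] at this
  have hkc : ∀ y ∈ S, Continuous fun ω => meanSlope g (R y ω) (R x ω) := fun y hy =>
    (continuous_meanSlope hG.continuous).comp ((hR y hy).continuous.prodMk (hR x hx).continuous)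
  have hI : Tendsto (fun y => ∫ ω in y..P y, meanSlope g (R y ω) (R x ω)) (𝓝[S] x)
      (𝓝 (∫ ω in x..P x, g (R x ω))) := by
    have h1 : Tendsto (fun y => ∫ ω in x..P x, meanSlope g (R y ω) (R x ω)) (𝓝[S] x)
        (𝓝 (∫ ω in x..P x, g (R x ω))) := by
      refine tendsto_integral_filter_of_dominated_convergence (fun _ => L) ?_ ?_ (by simp) ?_
      · filter_upwards [hself] with y hy
        exact (hkc y hy).aestronglyMeasurable
      · exact Eventually.of_forall fun y => ae_of_all _ fun ω _ => abs_meanSlope_le hG.abs_le _ _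
      · refine ae_of_all _ fun ω hω => ?_
        have hωM : ω ∈ Icc (-M) M := by
          have := uIoc_subset_uIcc hω
          exact uIcc_subset_Icc (hSM hx) (hPM hx) this
        rw [← meanSlope_self g (R x ω)]
        exact ((continuous_meanSlope hG.continuous).tendsto (R x ω, R x ω)).comp
          ((hRt ω hωM).prodMk_nhds tendsto_const_nhds)
    have h2 : Tendsto (fun y => (∫ ω in y..x, meanSlope g (R y ω) (R x ω)) +
        ∫ ω in P x..P y, meanSlope g (R y ω) (R x ω)) (𝓝[S] x) (𝓝 0) := by
      have hlim : Tendsto (fun y => L * |x - y| + L * |P y - P x|) (𝓝[S] x) (𝓝 0) := by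
        have ha : Tendsto (fun y => L * |x - y|) (𝓝[S] x) (𝓝 0) := by
          have : Continuous fun y => L * |x - y| := by fun_prop
          simpa using (this.tendsto x).mono_left nhdsWithin_le_nhds
        have hb : Tendsto (fun y => L * |P y - P x|) (𝓝[S] x) (𝓝 0) := by
          simpa using ((hPx.sub_const (P x)).abs).const_mul L
        simpa using ha.add hb
      refine squeeze_zero_norm (fun y => (norm_add_le _ _).trans ?_) hlim
      exact add_le_add (abs_integral_meanSlope_le hG.abs_le _ _ _ _)
        (abs_integral_meanSlope_le hG.abs_le _ _ _ _)
    have h3 := h1.add h2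
    rw [add_zero] at h3
    refine h3.congr' ?_
    filter_upwards [hself] with y hy
    have hi : ∀ a b, IntervalIntegrable (fun ω => meanSlope g (R y ω) (R x ω)) volume a b :=
      fun a b => (hkc y hy).intervalIntegrable a b
    rw [← integral_add_adjacent_intervals (hi y x) (hi x (P y)),
      ← integral_add_adjacent_intervals (hi x (P x)) (hi (P x) (P y))]
    ring
  have hGP : G 0 - P x ≠ 0 := by
    have := hG.le 0
    have := (hP x hx).1
    linarith
  have hdP : HasDerivAt (R x) (G 0 - P x) (P x) := by
    simpa [hRP x hx] using (hR x hx).hasDerivAt _ (hPM hx)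
  have hdx : HasDerivWithinAt (R x) (G 0 - x) S x := by
    simpa [(hR x hx).init] using ((hR x hx).hasDerivAt _ (hSM hx)).hasDerivWithinAt (s := S)
  -- `dslope` is used because `P y = P x` is not excluded a priori.
  have hslope : Tendsto (fun y => dslope (R x) (P x) (P y)) (𝓝[S] x) (𝓝 (G 0 - P x)) := by
    have := (continuousAt_dslope_same.2 hdP.differentiableAt).tendsto.comp hPx
    rwa [dslope_same, hdP.deriv] at this
  rw [hasDerivWithinAt_iff_tendsto_slope] at hdx ⊢
  have hmono : 𝓝[S \ {x}] x ≤ 𝓝[S] x := nhdsWithin_mono _ sdiff_subset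
  have hlim := (hdx.div (hslope.mono_left hmono) hGP).mul
    ((Real.continuous_exp.tendsto _).comp (hI.mono_left hmono))
  refine hlim.congr' ?_
  filter_upwards [(hslope.mono_left hmono).eventually_ne hGP, self_mem_nhdsWithin] with y hne hy
  have hyx : y - x ≠ 0 := sub_ne_zero.2 hy.2
  have h1 : (P y - P x) * dslope (R x) (P x) (P y) = R x (P y) := by
    have := sub_smul_dslope (R x) (P x) (P y)
    rwa [hRP x hx, sub_zero, smul_eq_mul] at this
  -- At `t = P y` the comparison identity reads `R x (P y) = R x y * exp (...)`; dividing both sides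
  -- by `y - x` gives the slope of `P`.
  have h2 := hdiff y hy.1 (P y) (hPM hy.1)
  rw [hRP y hy.1, sub_zero] at h2
  simp only [Pi.div_apply, slope_def_field, (hR x hx).init, sub_zero, Function.comp_apply]
  rw [div_div, div_mul_eq_mul_div, ← h2, ← h1]
  field_simp

/-! ### Closeness of the return map and its derivative to those of `x ↦ -x` -/

section Estimates

variable {G g : ℝ → ℝ} {L ν M N x σ : ℝ} {r : ℝ → ℝ}

/-- Outside two end layers of width `d = 2σ/ν` the parabola forces `r ≥ σ`, so `G ≤ σ`. Each layer
adds at most `3ν/4 * d = 3σ/2` to the energy, the middle at most `2Nσ`. -/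
theorem IsArc.apply_neg_le (hG : IsForcing G g L ν) (hν : 0 < ν) (hr : IsArc G M x r)
    (hx : x ≤ -ν) (hxN : -N ≤ x) (hM : -x ≤ M) (hσ : 0 < σ) (hσν : 2 * σ ≤ ν ^ 2)
    (hs : ∀ ρ, σ ≤ ρ → G ρ ≤ σ) : r (-x) ≤ (3 + 2 * N) * σ := by
  have hd0 : 0 ≤ 2 * σ / ν := by positivity
  have hdν : 2 * σ / ν ≤ ν := by rw [div_le_iff₀ hν]; nlinarith
  have hνd : ν * (2 * σ / ν) = 2 * σ := by field_simp
  set d := 2 * σ / ν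
  have h1 := hr.energy_sub_le (s := x) (t := x + d) (C := 3 * ν / 4) (by linarith) (by linarith)
    (by linarith) fun ω _ => hG.le _
  have h2 := hr.energy_sub_le (s := x + d) (t := -x - d) (C := σ) (by linarith) (by linarith)
    (by linarith) fun ω hω => hs _ <| by
      have := hr.le_apply hG (ω := ω) (by linarith) (by linarith [hω.1]) (by linarith [hω.2])
      nlinarith [mul_nonneg (sub_nonneg.2 hω.1) (sub_nonneg.2 hω.2),
        mul_nonneg hd0 (show 0 ≤ -x - ν by linarith), mul_nonneg hd0 (sub_nonneg.2 hdν)]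
  have h3 := hr.energy_sub_le (s := -x - d) (t := -x) (C := 3 * ν / 4) (by linarith)
    (by linarith) (by linarith) fun ω _ => hG.le _
  rw [hr.init] at h1
  nlinarith [mul_nonneg hσ.le hd0, mul_nonneg hσ.le (show 0 ≤ x + N by linarith)]

theorem IsArc.return_sub_le (hG : IsForcing G g L ν) (hν : 0 < ν) (hr : IsArc G M x r)
    (hx : x ≤ -ν) (hxN : -N ≤ x) (hσ : 0 < σ) (hσν : 2 * σ ≤ ν ^ 2)
    (hs : ∀ ρ, σ ≤ ρ → G ρ ≤ σ) {P : ℝ} (hxP : -x ≤ P) (hPM : P ≤ M) (hP : r P = 0) :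
    P + x ≤ 4 / ν * (3 + 2 * N) * σ := by
  have h1 := hr.apply_neg_le hG hν hx hxN (hxP.trans hPM) hσ hσν hs
  have h2 := hr.sub_le hG hν (s := -x) (t := P) (by linarith) hxP hPM
  rw [hP] at h2
  rw [mul_assoc, div_mul_eq_mul_div, le_div_iff₀ hν]
  linarith

/-- The logarithm of minus the derivative of the return map. -/
theorem IsArc.abs_log_deriv_le (hG : IsForcing G g L ν) (hν : 0 < ν) (hr : IsArc G M x r)
    (hx : x ≤ -ν) (hxN : -N ≤ x) (hσ : 0 < σ) (hσν : 16 * σ ≤ ν ^ 2) (hσν' : 4 * σ ≤ ν)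
    (hs : ∀ ρ, σ ≤ ρ → G ρ ≤ σ) (hs' : ∀ ρ, σ ≤ ρ → |g ρ| ≤ σ)
    {P : ℝ} (hxP : -x ≤ P) (hPx : P ≤ -(7 * x)) (hPM : P ≤ M) (hP : r P = 0) :
    |Real.log (G 0 - x) - Real.log (P - G 0) + ∫ ω in x..P, g (r ω)| ≤
      (4 / ν * (3 + 2 * N) * (1 / ν + 40 * N / ν ^ 2) + 2 * ν + 4 / ν) * σ := by
  have hret := hr.return_sub_le hG hν hx hxN hσ (by linarith [sq_nonneg ν]) hs hxP hPM hP
  have hκ : 0 ≤ P + x := by linarith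
  set κ := 4 / ν * (3 + 2 * N) * σ with hκdef
  have hgc : Continuous fun ω => g (r ω) := hG.continuous.comp hr.continuous
  set E : ℝ → ℝ := fun ω => ∫ u in x..ω, g (r u) with hE
  have hEd : ∀ ω, HasDerivAt E (g (r ω)) ω := hasDerivAt_primitive hgc x
  have hEx : E x = 0 := by simp [hE]
  have hGd : ∀ ω ∈ Icc x P, HasDerivAt (fun ω => G (r ω)) (g (r ω) * (G (r ω) - ω)) ω :=
    fun ω hω => (hG.hasDerivAt (r ω)).comp ω
      (hr.hasDerivAt ω ⟨by linarith [hω.1], by linarith [hω.2]⟩)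
  -- `c < ν` makes `r ≥ σ` on `[-c, c]`, while `c > 3ν/4` keeps `ω - G` at least `ν/8` for `ω ≥ c`.
  set c := 7 * ν / 8 with hc
  have hS : ∀ ω ∈ Icc x P, HasDerivAt (fun ω => 10 / ν ^ 2 * (r ω + ω ^ 2 / 2))
      (10 / ν ^ 2 * G (r ω)) ω := fun ω hω =>
    (hr.hasDerivAt_energy ⟨by linarith [hω.1], by linarith [hω.2]⟩).const_mul _
  have hsmall : ∀ ω ∈ Icc (-c) c, σ ≤ r ω := by
    intro ω hω
    have := hr.le_apply hG (ω := ω) (by linarith) (by linarith [hω.1]) (by linarith [hω.2])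
    nlinarith [mul_nonneg (sub_nonneg.2 hω.1) (sub_nonneg.2 hω.2),
      mul_nonneg (show 0 ≤ -x - ν by linarith) (show 0 ≤ -x + ν by linarith)]
  have hfrac : ∀ {p q Γ : ℝ}, 0 ≤ Γ → 7 * ν / 8 ≤ p → ν / 8 ≤ q → Γ / (p * q) ≤ 10 / ν ^ 2 * Γ := by
    intro p q Γ hΓ hp hq
    have hpq : ν ^ 2 / 10 ≤ p * q := by
      nlinarith [mul_le_mul hp hq (by positivity) (by linarith)]
    rw [div_le_iff₀ (by nlinarith [pow_pos hν 2])]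
    calc Γ = 10 / ν ^ 2 * Γ * (ν ^ 2 / 10) := by field_simp
      _ ≤ _ := by gcongr
  -- Adding the logarithms cancels `g` from the derivative. What remains is `-G / (-ω (G - ω))`,
  -- dominated by a multiple of the growth rate of the energy.
  have hJ₁ := abs_sub_le_of_abs_deriv_le (s := x) (t := -c)
    (f := fun ω => E ω - Real.log (G (r ω) - ω) + Real.log (-ω))
    (f' := fun ω => g (r ω) - (g (r ω) * (G (r ω) - ω) - 1) / (G (r ω) - ω) + -1 / -ω)
    (by linarith)
    (fun ω hω => by
      have hpos : G (r ω) - ω ≠ 0 := by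
        have := hG.nonneg (r ω)
        linarith [hω.2]
      exact ((hEd ω).sub (((hGd ω ⟨hω.1, by linarith [hω.2]⟩).sub (hasDerivAt_id ω)).log
        hpos)).add ((hasDerivAt_id ω).neg.log (by simp only [Pi.neg_apply, id]; linarith [hω.2])))
    (fun ω hω => hS ω ⟨hω.1, by linarith [hω.2]⟩)
    (fun ω hω => by
      have h0 := hG.nonneg (r ω)
      have hω0 : ω ≠ 0 := by linarith [hω.2]
      have hpos : G (r ω) - ω ≠ 0 := by linarith [hω.2]
      have he : g (r ω) - (g (r ω) * (G (r ω) - ω) - 1) / (G (r ω) - ω) + -1 / -ω =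
          -(G (r ω) / (-ω * (G (r ω) - ω))) := by
        field_simp
        ring
      rw [he, abs_neg, abs_of_nonneg (div_nonneg h0
        (mul_nonneg (by linarith [hω.2]) (by linarith [hω.2])))]
      exact hfrac h0 (by linarith [hω.2]) (by linarith [hω.2]))
  have hJ₂ := abs_sub_le_of_abs_deriv_le (s := c) (t := P)
    (f := fun ω => E ω - Real.log (ω - G (r ω)) + Real.log ω)
    (f' := fun ω => g (r ω) - (1 - g (r ω) * (G (r ω) - ω)) / (ω - G (r ω)) + 1 / ω)
    (by linarith)
    (fun ω hω => by
      have hpos : ω - G (r ω) ≠ 0 := by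
        have := hG.le (r ω)
        linarith [hω.1]
      exact ((hEd ω).sub (((hasDerivAt_id ω).sub (hGd ω ⟨by linarith [hω.1], hω.2⟩)).log
        hpos)).add ((hasDerivAt_id ω).log (by simp only [id]; linarith [hω.1])))
    (fun ω hω => hS ω ⟨by linarith [hω.1], hω.2⟩)
    (fun ω hω => by
      have h0 := hG.nonneg (r ω)
      have h1 := hG.le (r ω)
      have hω0 : ω ≠ 0 := by linarith [hω.1]
      have hpos : ω - G (r ω) ≠ 0 := by linarith [hω.1]
      have he : g (r ω) - (1 - g (r ω) * (G (r ω) - ω)) / (ω - G (r ω)) + 1 / ω =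
          -(G (r ω) / (ω * (ω - G (r ω)))) := by
        field_simp
        ring
      rw [he, abs_neg, abs_of_nonneg (div_nonneg h0
        (mul_nonneg (by linarith [hω.1]) (by linarith [hω.1])))]
      exact hfrac h0 (by linarith [hω.1]) (by linarith [hω.1]))
  have hmid := abs_sub_le_of_abs_deriv_le (s := -c) (t := c) (f := E) (h := fun ω => σ * ω)
    (h' := fun _ => σ * 1) (by linarith) (fun ω _ => hEd ω)
    (fun ω _ => (hasDerivAt_id ω).const_mul σ)
    (fun ω hω => by simpa using hs' _ (hsmall ω hω))
  -- Monotonicity across the middle lets the energy gains of the two outer pieces be bounded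
  -- together by the total gain from `x` to `P`.
  have hmono := hr.energy_mono hG (s := -c) (t := c) (by linarith) (by linarith) (by linarith)
  have hen : 10 / ν ^ 2 * (r P + P ^ 2 / 2) - 10 / ν ^ 2 * (r x + x ^ 2 / 2) ≤
      10 / ν ^ 2 * (κ * (4 * N)) := by
    rw [← mul_sub, hP, hr.init]
    refine mul_le_mul_of_nonneg_left ?_ (by positivity)
    have : (P + x) * (P - x) ≤ κ * (8 * N) :=
      mul_le_mul hret (by linarith) (by linarith) (hκ.trans hret)
    linarith
  have hmono' := mul_le_mul_of_nonneg_left hmono (show 0 ≤ 10 / ν ^ 2 by positivity)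
  have hGm := hs _ (hsmall (-c) ⟨le_rfl, by linarith⟩)
  have hGp := hs _ (hsmall c ⟨by linarith, le_rfl⟩)
  have hGm0 := hG.nonneg (r (-c))
  have hGp0 := hG.nonneg (r c)
  have hlogc : |Real.log (G (r (-c)) + c) - Real.log (c - G (r c))| ≤ 4 / ν * σ := by
    rw [← Real.log_div (by linarith) (by linarith)]
    have hpos : 0 < c - G (r c) := by linarith
    rw [abs_of_nonneg (Real.log_nonneg (by rw [le_div_iff₀ hpos]; linarith))]
    refine (Real.log_le_sub_one_of_pos (div_pos (by linarith) hpos)).trans ?_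
    rw [div_sub_one hpos.ne', div_le_iff₀ hpos]
    have : 2 * σ ≤ 4 / ν * σ * (c - G (r c)) := by
      calc 2 * σ = 4 / ν * σ * (ν / 2) := by field_simp; norm_num
        _ ≤ _ := by gcongr; linarith
    linarith
  have hlogP : |Real.log P - Real.log (-x)| ≤ κ / ν := by
    have hx0 : 0 < -x := by linarith
    rw [← Real.log_div (by linarith) hx0.ne']
    rw [abs_of_nonneg (Real.log_nonneg (by rw [le_div_iff₀ hx0]; linarith))]
    refine (Real.log_le_sub_one_of_pos (div_pos (by linarith) hx0)).trans ?_
    rw [div_sub_one hx0.ne']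
    exact div_le_div₀ (hκ.trans hret) (by linarith) hν (by linarith)
  simp only [hP, hr.init, hEx, sub_neg_eq_add, neg_neg] at hJ₁ hJ₂ hmid hen hmono'
  have hgoal : (4 / ν * (3 + 2 * N) * (1 / ν + 40 * N / ν ^ 2) + 2 * ν + 4 / ν) * σ =
      κ / ν + 10 / ν ^ 2 * (κ * (4 * N)) + 2 * ν * σ + 4 / ν * σ := by
    rw [hκdef]; ring
  rw [hgoal]
  have hcσ : σ * c ≤ ν * σ := by nlinarith
  rw [abs_le] at *
  change -_ ≤ Real.log (G 0 - x) - Real.log (P - G 0) + E P ∧ _ + E P ≤ _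
  constructor <;> linarith [hJ₁.1, hJ₁.2, hJ₂.1, hJ₂.2, hmid.1, hmid.2, hlogc.1, hlogc.2,
    hlogP.1, hlogP.2]

end Estimates

/-- The maps are fixed before `σ`, so one return map serves every precision. The bounds do not
involve `L`, which may blow up as `η → 0`. -/
theorem exists_return_map {G g : ℝ → ℝ} {L ν N : ℝ} (hG : IsForcing G g L ν) (hν : 0 < ν) :
    ∃ (R : ℝ → ℝ → ℝ) (P D : ℝ → ℝ), ∀ x ∈ Icc (-N) (-ν),
      IsArc G (7 * N) x (R x) ∧ P x ∈ Icc (-x) (7 * N) ∧ R x (P x) = 0 ∧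
      (∀ ω ∈ Ioo x (P x), 0 < R x ω) ∧ HasDerivWithinAt P (D x) (Icc (-N) (-ν)) x ∧
      ∀ σ, 0 < σ → 16 * σ ≤ ν ^ 2 → 4 * σ ≤ ν →
        (4 / ν * (3 + 2 * N) * (1 / ν + 40 * N / ν ^ 2) + 2 * ν + 4 / ν) * σ ≤ 1 →
        (∀ ρ, σ ≤ ρ → G ρ ≤ σ) → (∀ ρ, σ ≤ ρ → |g ρ| ≤ σ) →
        |P x - -x| ≤ 4 / ν * (3 + 2 * N) * σ ∧
        |D x - -1| ≤
          2 * ((4 / ν * (3 + 2 * N) * (1 / ν + 40 * N / ν ^ 2) + 2 * ν + 4 / ν) * σ) := by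
  have hex : ∀ x, ∃ r : ℝ → ℝ, ∃ P : ℝ, x ∈ Icc (-N) (-ν) → IsArc G (7 * N) x r ∧ -x ≤ P ∧
      P ≤ -(7 * x) ∧ r P = 0 ∧ ∀ ω ∈ Ioo x P, 0 < r ω := by
    intro x
    by_cases hx : x ∈ Icc (-N) (-ν)
    · obtain ⟨r, hr⟩ := hG.exists_isArc (M := 7 * N) (x := x)
        ⟨by linarith [hx.1, hx.2], by linarith [hx.1, hx.2]⟩
      obtain ⟨P, hP⟩ := hr.exists_return hG hν hx.2 (by linarith [hx.1])
      exact ⟨r, P, fun _ => ⟨hr, hP⟩⟩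
    · exact ⟨0, 0, fun h => absurd h hx⟩
  choose R P h using hex
  refine ⟨R, P, fun x => (G 0 - x) / (G 0 - P x) * Real.exp (∫ ω in x..P x, g (R x ω)),
    fun x hx => ?_⟩
  obtain ⟨hr, hxP, hPx, hP0, hpos⟩ := h x hx
  have hPN : P x ≤ 7 * N := by linarith [hx.1]
  refine ⟨hr, ⟨hxP, hPN⟩, hP0, hpos, ?_, ?_⟩
  · refine hasDerivWithinAt_return (M := 7 * N) hG hν ?_ (fun y hy => (h y hy).1)
      (fun y hy => ?_) (fun y hy => (h y hy).2.2.2.1) hx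
    · exact Icc_subset_Icc_left (by linarith [hx.1, hx.2])
    · obtain ⟨-, h1, h2, -⟩ := h y hy
      exact ⟨by linarith [hy.2], by linarith [hy.1]⟩
  · intro σ hσ hσ1 hσ2 hσ3 hs hs'
    have hret := hr.return_sub_le hG hν hx.2 hx.1 hσ (by linarith [sq_nonneg ν]) hs hxP hPN hP0
    refine ⟨by rw [sub_neg_eq_add, abs_of_nonneg (by linarith)]; exact hret, ?_⟩
    have hlog := hr.abs_log_deriv_le hG hν hx.2 hx.1 hσ hσ1 hσ2 hs hs' hxP hPx hPN hP0
    set Λ := Real.log (G 0 - x) - Real.log (P x - G 0) + ∫ ω in x..P x, g (R x ω) with hΛ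
    have h0 := hG.nonneg 0
    have h1 := hG.le 0
    have hD : (G 0 - x) / (G 0 - P x) * Real.exp (∫ ω in x..P x, g (R x ω)) - -1 =
        -(Real.exp Λ - 1) := by
      rw [hΛ, Real.exp_add, Real.exp_sub, Real.exp_log (by linarith [hx.2]),
        Real.exp_log (by linarith [hx.2]), ← neg_sub (P x) (G 0), div_neg]
      ring
    rw [hD, abs_neg]
    exact (Real.abs_exp_sub_one_le (hlog.trans hσ3)).trans (by linarith)

/-! ### The forcing given by the invariant surface -/

/-- A nonincreasing-at-zero `C¹` function on `[0, ∞)` extends to a forcing on the line. -/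
theorem exists_isForcing_extension {f f' : ℝ → ℝ} {L q c ν : ℝ}
    (hf : ∀ r, 0 ≤ r → HasDerivAt f (f' r) r) (hcont : ContinuousOn f' (Ici 0))
    (hL : ∀ r, 0 ≤ r → |f' r| ≤ L) (h0 : ∀ r, 0 ≤ r → 0 ≤ f r) (hq : ∀ r, 0 ≤ r → f r ≤ q)
    (hneg : f' 0 ≤ 0) (hc : 0 < c) (hqc : q + c ≤ 3 * ν / 4) :
    ∃ G g : ℝ → ℝ, IsForcing G g L ν ∧ ∀ r, 0 ≤ r → G r = f r ∧ g r = f' r := by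
  -- This makes the slope of `c * (m r / (1 + m r))` at `0` equal to `f' 0`; for `r ≤ 0` the added
  -- term stays in `[0, c]`. Negative `r` matters since arcs are compared past their returns.
  set m := f' 0 / c with hm
  have hm0 : m ≤ 0 := div_nonpos_of_nonpos_of_nonneg hneg hc.le
  have hcm : c * m = f' 0 := by rw [hm]; field_simp
  have hpos : ∀ r, 1 ≤ 1 + m * min r 0 := fun r => by
    have := mul_nonneg_of_nonpos_of_nonpos hm0 (min_le_right r 0)
    linarith
  set G : ℝ → ℝ := fun r => f (max r 0) + c * (m * min r 0 / (1 + m * min r 0)) with hG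
  set g : ℝ → ℝ := fun r => f' (max r 0) + (f' 0 / (1 + m * min r 0) ^ 2 - f' 0) with hg
  have hGp : ∀ r, 0 ≤ r → G r = f r := fun r hr => by simp [hG, hr]
  have hgp : ∀ r, 0 ≤ r → g r = f' r := fun r hr => by simp [hg, hr]
  have hGn : ∀ r, r ≤ 0 → G r = f 0 + c * (m * r / (1 + m * r)) := fun r hr => by simp [hG, hr]
  have hgn : ∀ r, r ≤ 0 → g r = f' 0 / (1 + m * r) ^ 2 := fun r hr => by simp [hg, hr]
  have hdn : ∀ r, r ≤ 0 → HasDerivAt (fun r => f 0 + c * (m * r / (1 + m * r)))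
      (f' 0 / (1 + m * r) ^ 2) r := by
    intro r hr
    have hne : 1 + m * r ≠ 0 := by
      have := mul_nonneg_of_nonpos_of_nonpos hm0 hr
      linarith
    have h1 : HasDerivAt (fun r => m * r) m r := by simpa using (hasDerivAt_id r).const_mul m
    refine (((h1.div (h1.const_add 1) hne).const_mul c).const_add (f 0)).congr_deriv ?_
    rw [← hcm]
    ring
  have hfrac : ∀ r, 0 ≤ m * min r 0 / (1 + m * min r 0) ∧
      m * min r 0 / (1 + m * min r 0) ≤ 1 := fun r =>
    ⟨div_nonneg (by linarith [hpos r]) (by linarith [hpos r]),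
      div_le_one_of_le₀ (by linarith) (by linarith [hpos r])⟩
  refine ⟨G, g, ⟨fun r => ?_, ?_, fun r => ?_, fun r => ?_, fun r => ?_⟩,
    fun r hr => ⟨hGp r hr, hgp r hr⟩⟩
  · have hp : 0 ≤ r → HasDerivWithinAt G (g r) (Ici 0) r := fun hr => by
      rw [hgp r hr]
      exact (hf r hr).hasDerivWithinAt.congr hGp (hGp r hr)
    have hn : r ≤ 0 → HasDerivWithinAt G (g r) (Iic 0) r := fun hr => by
      rw [hgn r hr]
      exact (hdn r hr).hasDerivWithinAt.congr hGn (hGn r hr)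
    rcases lt_trichotomy r 0 with h | h | h
    · exact (hn h.le).hasDerivAt (Iic_mem_nhds h)
    · have := (hn h.le).union (hp h.ge)
      rwa [Iic_union_Ici, hasDerivWithinAt_univ] at this
    · exact (hp h.le).hasDerivAt (Ici_mem_nhds h)
  · have h1 : Continuous fun r : ℝ => f' (max r 0) :=
      hcont.comp_continuous (by fun_prop) fun r => le_max_right r 0
    have h2 : Continuous fun r : ℝ => f' 0 / (1 + m * min r 0) ^ 2 :=
      continuous_const.div (by fun_prop) fun r => by have := hpos r; positivity
    exact h1.add (h2.sub continuous_const)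
  · rcases le_total 0 r with h | h
    · rw [hgp r h]; exact hL r h
    · rw [hgn r h, abs_div]
      refine (div_le_self (abs_nonneg _) ?_).trans (hL 0 le_rfl)
      have := hpos r
      rw [min_eq_left h] at this
      rw [abs_of_nonneg (sq_nonneg _)]
      nlinarith
  · exact add_nonneg (h0 _ (le_max_right _ _)) (mul_nonneg hc.le (hfrac r).1)
  · have := hq (max r 0) (le_max_right _ _)
    have := mul_le_mul_of_nonneg_left (hfrac r).2 hc.le
    simp only [hG]
    linarith

/-- The inverse of `z ↦ (z ^ 2 - 1) / 2 + k * (z - 1)` on `z ≥ 1`. -/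
noncomputable def radius (k r : ℝ) : ℝ := Real.sqrt ((1 + k) ^ 2 + 2 * r) - k

section Radius

variable {k r : ℝ}

theorem radius_zero (hk : |k| ≤ 1 / 4) : radius k 0 = 1 := by
  rw [radius, mul_zero, add_zero, Real.sqrt_sq (by linarith [(abs_le.1 hk).1])]
  ring

theorem radius_add_sq (hr : 0 ≤ r) : (radius k r + k) ^ 2 = (1 + k) ^ 2 + 2 * r := by
  rw [radius, sub_add_cancel, Real.sq_sqrt (by positivity)]

theorem one_le_radius (hr : 0 ≤ r) : 1 ≤ radius k r := by
  have : 1 + k ≤ Real.sqrt ((1 + k) ^ 2 + 2 * r) := Real.le_sqrt_of_sq_le (by linarith)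
  rw [radius]
  linarith

theorem one_lt_radius (hr : 0 < r) : 1 < radius k r := by
  have : 1 + k < Real.sqrt ((1 + k) ^ 2 + 2 * r) := Real.lt_sqrt_of_sq_lt (by linarith)
  rw [radius]
  linarith

theorem radius_add_pos (hk : |k| ≤ 1 / 4) (hr : 0 ≤ r) : 3 / 4 ≤ radius k r + k := by
  linarith [one_le_radius (k := k) hr, (abs_le.1 hk).1]

theorem le_radius (hk : |k| ≤ 1 / 4) {σ : ℝ} (hσ : 0 ≤ σ) (hσ1 : σ ≤ 1) (hr : σ ≤ r) :
    1 + σ / 4 ≤ radius k r := by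
  have h1 := radius_add_sq (k := k) (hσ.trans hr)
  have h2 := radius_add_pos hk (hσ.trans hr)
  by_contra! h
  nlinarith [(abs_le.1 hk).1, (abs_le.1 hk).2]

theorem hasDerivAt_radius (hk : |k| ≤ 1 / 4) (hr : 0 ≤ r) :
    HasDerivAt (radius k) (1 / (radius k r + k)) r := by
  have hpos : 0 < (1 + k) ^ 2 + 2 * r := by
    have := (abs_le.1 hk).1
    nlinarith
  have h1 : HasDerivAt (fun r => (1 + k) ^ 2 + 2 * r) 2 r := by
    simpa using ((hasDerivAt_id r).const_mul 2).const_add ((1 + k) ^ 2)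
  refine ((h1.sqrt hpos.ne').sub_const k).congr_deriv ?_
  rw [radius, sub_add_cancel]
  field_simp

theorem continuous_radius : Continuous (radius k) := by
  unfold radius
  fun_prop

end Radius

/-- The product `z * q` on the invariant surface, as a function of `z`. -/
noncomputable def profile (l m q z : ℝ) : ℝ := q * ((z + l) / (1 + l)) * Real.exp (-(m * (z - 1)))

noncomputable def profileDeriv (l m q z : ℝ) : ℝ :=
  q / (1 + l) * (1 - m * (z + l)) * Real.exp (-(m * (z - 1)))

section Profile

variable {l m q z : ℝ}

theorem hasDerivAt_profile : HasDerivAt (profile l m q) (profileDeriv l m q z) z := by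
  have h1 : HasDerivAt (fun z => q * ((z + l) / (1 + l))) (q * (1 / (1 + l))) z :=
    (((hasDerivAt_id z).add_const l).div_const (1 + l)).const_mul q
  have h2 : HasDerivAt (fun z => -(m * (z - 1))) (-m) z :=
    (((hasDerivAt_id z).sub_const 1).const_mul m).neg.congr_deriv (by simp)
  refine (h1.mul h2.exp).congr_deriv ?_
  rw [profileDeriv]
  ring

theorem profile_one (hl : |l| ≤ 1 / 2) : profile l m q 1 = q := by
  have : 1 + l ≠ 0 := by linarith [(abs_le.1 hl).1]
  simp [profile, this]

/-- Absorbs the linear factor of the profile into the exponential, at the cost of lowering the rate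
`m` to `m - 2`. -/
theorem div_le_exp (hl : |l| ≤ 1 / 2) (hz : 1 ≤ z) :
    (z + l) / (1 + l) ≤ Real.exp (2 * (z - 1)) := by
  have h1 := (abs_le.1 hl).1
  have h2 := Real.add_one_le_exp (2 * (z - 1))
  refine le_trans ?_ h2
  rw [div_le_iff₀ (by linarith)]
  nlinarith

theorem profile_pos (hl : |l| ≤ 1 / 2) (hq : 0 < q) (hz : 1 ≤ z) : 0 < profile l m q z := by
  have h1 := (abs_le.1 hl).1
  exact mul_pos (mul_pos hq (div_pos (by linarith) (by linarith))) (Real.exp_pos _)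

theorem profile_le_exp (hl : |l| ≤ 1 / 2) (hq : 0 < q) (hz : 1 ≤ z) :
    profile l m q z ≤ q * Real.exp (-((m - 2) * (z - 1))) := by
  have : Real.exp (-((m - 2) * (z - 1))) =
      Real.exp (2 * (z - 1)) * Real.exp (-(m * (z - 1))) := by
    rw [← Real.exp_add]; ring_nf
  rw [profile, this, ← mul_assoc]
  gcongr
  exact div_le_exp hl hz

theorem profile_le (hl : |l| ≤ 1 / 2) (hq : 0 < q) (hm : 2 ≤ m) (hz : 1 ≤ z) :
    profile l m q z ≤ q := by
  refine (profile_le_exp hl hq hz).trans (mul_le_of_le_one_right hq.le ?_)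
  rw [Real.exp_le_one_iff]
  nlinarith

theorem abs_profileDeriv_le (hl : |l| ≤ 1 / 2) (hq : 0 < q) (hm : 2 ≤ m) (hz : 1 ≤ z) :
    |profileDeriv l m q z| ≤ q * (2 + m) * Real.exp (-((m - 2) * (z - 1))) := by
  have h1 := (abs_le.1 hl).1
  have hl1 : 0 < 1 + l := by linarith
  have he : Real.exp (-((m - 2) * (z - 1))) =
      Real.exp (2 * (z - 1)) * Real.exp (-(m * (z - 1))) := by
    rw [← Real.exp_add]; ring_nf
  have h2 : 1 ≤ Real.exp (2 * (z - 1)) := Real.one_le_exp (by linarith)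
  have h3 := div_le_exp hl hz
  have h4 : |(1 - m * (z + l)) / (1 + l)| ≤ (2 + m) * Real.exp (2 * (z - 1)) := by
    have h5 : 1 / (1 + l) ≤ 2 := by rw [div_le_iff₀ hl1]; linarith
    have h6 : 0 ≤ 1 / (1 + l) := by positivity
    have h7 : 0 ≤ (z + l) / (1 + l) := div_nonneg (by linarith) hl1.le
    have h8 : (1 - m * (z + l)) / (1 + l) = 1 / (1 + l) - m * ((z + l) / (1 + l)) := by ring
    rw [h8, abs_le]
    constructor <;> nlinarith
  calc |profileDeriv l m q z| =
        q * |(1 - m * (z + l)) / (1 + l)| * Real.exp (-(m * (z - 1))) := by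
        rw [profileDeriv, abs_mul, Real.abs_exp, ← abs_of_pos hq, ← abs_mul, abs_of_pos hq]
        ring_nf
    _ ≤ q * ((2 + m) * Real.exp (2 * (z - 1))) * Real.exp (-(m * (z - 1))) := by gcongr
    _ = _ := by rw [he]; ring

end Profile

theorem exists_isForcing_profile {k l m q ν : ℝ} (hk : |k| ≤ 1 / 4) (hl : |l| ≤ 1 / 2)
    (hm : 2 ≤ m) (hq : 0 < q) (hqν : 2 * q ≤ ν) :
    ∃ G g : ℝ → ℝ, IsForcing G g (2 * (q * (2 + m))) ν ∧
      (∀ r, 0 ≤ r → G r = profile l m q (radius k r)) ∧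
      ∀ σ, 0 < σ → σ ≤ 1 → 2 * (q * (2 + m)) * Real.exp (-((m - 2) * (σ / 4))) ≤ σ →
        (∀ ρ, σ ≤ ρ → G ρ ≤ σ) ∧ ∀ ρ, σ ≤ ρ → |g ρ| ≤ σ := by
  have hl1 := (abs_le.1 hl).1
  have hdb : ∀ r, 0 ≤ r → |profileDeriv l m q (radius k r) * (1 / (radius k r + k))| ≤
      2 * (q * (2 + m)) * Real.exp (-((m - 2) * (radius k r - 1))) := by
    intro r hr
    have h1 := abs_profileDeriv_le hl hq hm (one_le_radius (k := k) hr)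
    have h2 := radius_add_pos hk hr
    have h3 : 1 / (radius k r + k) ≤ 2 := by
      rw [div_le_iff₀ (by linarith)]; linarith
    have h4 : 0 ≤ 1 / (radius k r + k) := by positivity
    rw [abs_mul, abs_of_nonneg h4]
    refine (mul_le_mul h1 h3 h4 (by positivity)).trans (le_of_eq (by ring))
  have hexp : ∀ r, 0 ≤ r → Real.exp (-((m - 2) * (radius k r - 1))) ≤ 1 := fun r hr => by
    rw [Real.exp_le_one_iff]
    nlinarith [one_le_radius (k := k) hr]
  obtain ⟨G, g, hG, hGg⟩ := exists_isForcing_extension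
    (f := fun r => profile l m q (radius k r))
    (f' := fun r => profileDeriv l m q (radius k r) * (1 / (radius k r + k)))
    (L := 2 * (q * (2 + m))) (q := q) (c := ν / 4) (ν := ν)
    (fun r hr => hasDerivAt_profile.comp r (hasDerivAt_radius hk hr))
    (by
      have h1 : Continuous fun r => profileDeriv l m q (radius k r) := by
        have := continuous_radius (k := k)
        unfold profileDeriv
        fun_prop
      refine h1.continuousOn.mul (continuousOn_const.div ?_ fun r hr => ?_)
      · exact (continuous_radius.add continuous_const).continuousOn
      · linarith [radius_add_pos hk hr])
    (fun r hr => (hdb r hr).trans (mul_le_of_le_one_right (by positivity) (hexp r hr)))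
    (fun r hr => (profile_pos hl hq (one_le_radius hr)).le)
    (fun r hr => profile_le hl hq hm (one_le_radius hr))
    (by
      have h2 := radius_add_pos hk (le_refl 0)
      refine mul_nonpos_of_nonpos_of_nonneg ?_ (by positivity)
      rw [radius_zero hk, profileDeriv]
      refine mul_nonpos_of_nonpos_of_nonneg (mul_nonpos_of_nonneg_of_nonpos ?_ ?_)
        (Real.exp_pos _).le
      · exact div_nonneg hq.le (by linarith)
      · nlinarith)
    (by linarith) (by linarith)
  refine ⟨G, g, hG, fun r hr => (hGg r hr).1, fun σ hσ hσ1 hσ2 => ?_⟩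
  have hmono : ∀ ρ, σ ≤ ρ → Real.exp (-((m - 2) * (radius k ρ - 1))) ≤
      Real.exp (-((m - 2) * (σ / 4))) := fun ρ hρ => by
    have := le_radius hk hσ.le hσ1 hρ
    rw [Real.exp_le_exp, neg_le_neg_iff]
    exact mul_le_mul_of_nonneg_left (by linarith) (by linarith)
  refine ⟨fun ρ hρ => ?_, fun ρ hρ => ?_⟩
  · rw [(hGg ρ (hσ.le.trans hρ)).1]
    refine (profile_le_exp hl hq (one_le_radius (hσ.le.trans hρ))).trans (le_trans ?_ hσ2)
    refine mul_le_mul ?_ (hmono ρ hρ) (Real.exp_pos _).le (by positivity)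
    nlinarith
  · rw [(hGg ρ (hσ.le.trans hρ)).2]
    refine (hdb ρ (hσ.le.trans hρ)).trans (le_trans ?_ hσ2)
    exact mul_le_mul_of_nonneg_left (hmono ρ hρ) (by positivity)

/-! ### From arcs back to orbits of the vector field -/

/-- A curve whose velocity is a positive multiple of a vector field can be reparametrized as an
integral curve. -/
theorem exists_time_change {E : Type*} [NormedAddCommGroup E] [NormedSpace ℝ E] {c : ℝ → E}
    {V : E → E} {ρ : ℝ → ℝ} {a b m : ℝ} (hab : a < b) (hρ : ContinuousOn ρ (Icc a b)) (hm : 0 < m)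
    (hρm : ∀ ω ∈ Icc a b, m ≤ ρ ω)
    (hc : ∀ ω ∈ Icc a b, HasDerivWithinAt c (ρ ω • V (c ω)) (Icc a b) ω) :
    ∃ T, 0 < T ∧ ∃ φ : ℝ → ℝ, φ 0 = a ∧ φ T = b ∧
      (∀ t ∈ Icc 0 T, φ t ∈ Icc a b ∧
        HasDerivWithinAt (fun t => c (φ t)) (V (c (φ t))) (Icc 0 T) t) ∧
      ∀ t ∈ Ioo 0 T, φ t ∈ Ioo a b := by
  -- Extended to the line, `ρ` has as primitive an increasing bijection of `ℝ`, whose inverse is the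
  -- time change.
  set ρ' : ℝ → ℝ := IccExtend hab.le ((Icc a b).domRestrict ρ) with hρ'
  have hρ'c : Continuous ρ' := hρ.domRestrict.Icc_extend'
  have hρ'e : ∀ t ∈ Icc a b, ρ' t = ρ t := fun t ht => by
    rw [hρ', IccExtend_of_mem hab.le _ ht, domRestrict_apply]
  have hρ'm : ∀ t, m ≤ ρ' t := fun t => hρm _ (projIcc a b hab.le t).2
  set τ : ℝ → ℝ := fun ω => ∫ s in a..ω, ρ' s with hτ
  have hτd : ∀ ω, HasDerivAt τ (ρ' ω) ω := hasDerivAt_primitive hρ'c a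
  have hτa : τ a = 0 := by simp [hτ]
  have hτm : ∀ {s t}, s ≤ t → m * (t - s) ≤ τ t - τ s := fun {s t} hst => by
    have := sub_le_of_hasDerivAt_le (f := fun ω => -τ ω) (C := -m) hst
      (fun ω _ => (hτd ω).neg) fun ω _ => neg_le_neg (hρ'm ω)
    linarith
  have hmono : StrictMono τ := fun s t hst => by
    have := hτm hst.le
    nlinarith [mul_pos hm (sub_pos.2 hst)]
  have hcont : Continuous τ := continuous_iff_continuousAt.2 fun ω => (hτd ω).continuousAt
  have hsurj : Function.Surjective τ := by
    refine hcont.surjective ?_ ?_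
    · refine tendsto_atTop_mono' _ ?_ ((tendsto_atTop_add_const_right atTop (-a)
        tendsto_id).const_mul_atTop hm)
      filter_upwards [eventually_ge_atTop a] with t ht
      have := hτm ht
      rw [hτa] at this
      simpa [sub_eq_add_neg] using this
    · refine tendsto_atBot_mono' _ ?_ ((tendsto_atBot_add_const_right atBot (-a)
        tendsto_id).const_mul_atBot hm)
      filter_upwards [eventually_le_atBot a] with t ht
      have := hτm ht
      rw [hτa] at this
      simp only [id]
      linarith
  set e := hmono.orderIsoOfSurjective τ hsurj with he
  have heτ : ∀ ω, e ω = τ ω := fun ω => rfl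
  have hτe : ∀ t, τ (e.symm t) = t := fun t => e.apply_symm_apply t
  have heb : e.symm (τ b) = b := e.symm_apply_apply b
  have hea : e.symm 0 = a := by
    rw [← hτa]; exact e.symm_apply_apply a
  have hφd : ∀ t, HasDerivAt e.symm (ρ' (e.symm t))⁻¹ t := fun t =>
    (hτd (e.symm t)).of_local_left_inverse e.symm.continuous.continuousAt
      (hm.trans_le (hρ'm _)).ne' (Eventually.of_forall hτe)
  have hmem : ∀ t ∈ Icc 0 (τ b), e.symm t ∈ Icc a b := fun t ht =>
    ⟨by rw [← hea]; exact e.symm.monotone ht.1, by rw [← heb]; exact e.symm.monotone ht.2⟩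
  refine ⟨τ b, by rw [← hτa]; exact hmono hab, e.symm, hea, heb, fun t ht => ⟨hmem t ht, ?_⟩,
    fun t ht => ⟨?_, ?_⟩⟩
  · have := (hc _ (hmem t ht)).scomp t (hφd t).hasDerivWithinAt hmem
    rw [hρ'e _ (hmem t ht), smul_smul,
      inv_mul_cancel₀ (hm.trans_le (hρm _ (hmem t ht))).ne', one_smul] at this
    exact this
  · rw [← hea]; exact e.symm.strictMono ht.1
  · conv_rhs => rw [← heb]
    exact e.symm.strictMono ht.2

theorem profileDeriv_eq {l m q z : ℝ} (hz : z + l ≠ 0) :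
    profileDeriv l m q z = profile l m q z / (z + l) - m * profile l m q z := by
  rw [profileDeriv, profile]
  field_simp

/-- The curve in the scaling chart that belongs to `z = η / y` and `ω = x₂ z`. -/
noncomputable def orbitCurve (a b η q : ℝ) (ζ : ℝ → ℝ) (ω : ℝ) : ℝ × ℝ × ℝ :=
  (ω / ζ ω, η / ζ ω, profile (a * η) (b / η) q (ζ ω) / ζ ω)

theorem hasDerivAt_orbitCurve {a b α η q ω : ℝ} {ζ : ℝ → ℝ} (hη : 0 < η) (hζ : 0 < ζ ω)
    (hk : 0 < ζ ω + α * η) (hl : 0 < ζ ω + a * η)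
    (h : HasDerivAt ζ ((profile (a * η) (b / η) q (ζ ω) - ω) / (ζ ω + α * η)) ω) :
    HasDerivAt (orbitCurve a b η q ζ)
      ((ζ ω / (η * (ζ ω + α * η))) • scalingField a b α (orbitCurve a b η q ζ ω)) ω := by
  have h1 := (hasDerivAt_id ω).div h hζ.ne'
  have h2 := (hasDerivAt_const ω η).div h hζ.ne'
  have h3 := ((hasDerivAt_profile (l := a * η) (m := b / η) (q := q) (z := ζ ω)).comp ω h).div h
    hζ.ne'
  refine (h1.prodMk (h2.prodMk h3)).congr_deriv ?_
  rw [profileDeriv_eq hl.ne']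
  simp only [orbitCurve, scalingField, Prod.smul_mk, smul_eq_mul, Function.comp_apply, id]
  generalize profile (a * η) (b / η) q (ζ ω) = p
  generalize ζ ω = z at *
  have h4 : 1 + a * (η / z) = (z + a * η) / z := by field_simp
  rw [h4]
  ext
  · simp only
    field_simp
    ring
  · simp only
    field_simp
    ring
  · simp only
    field_simp
    ring

theorem IsArc.isFirstReturn {a b α η q x P M : ℝ} {G r : ℝ → ℝ} {W S : Set (ℝ × ℝ × ℝ)}
    (hη : 0 < η) (hq : 0 < q) (hk : |α * η| ≤ 1 / 4) (hl : |a * η| ≤ 1 / 2) (hm : 2 ≤ b / η)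
    (hG : ∀ r, 0 ≤ r → G r = profile (a * η) (b / η) q (radius (α * η) r))
    (hr : IsArc G M x r) (hMx : -M ≤ x) (hPM : P ≤ M) (hx : x < 0) (hP : 0 < P) (hrP : r P = 0)
    (hpos : ∀ ω ∈ Ioo x P, 0 < r ω)
    (hW : ∀ X ∈ Icc x P, ∀ Y ∈ Icc 0 η, ∀ Z ∈ Icc 0 q, (X, Y, Z) ∈ W)
    (hS : ∀ p ∈ S, p.2.2 = q) (hxS : (x, η, q) ∈ S) (hPS : (P, η, q) ∈ S) :
    IsFirstReturn (scalingField a b α) W S (x, η, q) (P, η, q) := by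
  have hk1 := abs_le.1 hk
  have hl1 := abs_le.1 hl
  have hxP : x < P := hx.trans hP
  have hr0 : ∀ ω ∈ Icc x P, 0 ≤ r ω := fun ω hω => by
    rcases eq_or_lt_of_le hω.1 with h | h
    · rw [← h, hr.init]
    rcases eq_or_lt_of_le hω.2 with h' | h'
    · rw [h', hrP]
    exact (hpos ω ⟨h, h'⟩).le
  set ζ : ℝ → ℝ := fun ω => radius (α * η) (r ω) with hζ
  have hζ1 : ∀ ω ∈ Icc x P, 1 ≤ ζ ω := fun ω hω => one_le_radius (hr0 ω hω)
  have hζc : Continuous ζ := continuous_radius.comp hr.continuous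
  have hend : ∀ ω, r ω = 0 → orbitCurve a b η q ζ ω = (ω, η, q) := fun ω hω => by
    simp only [orbitCurve, hζ, hω, radius_zero hk, profile_one hl, div_one]
  have hcurve : ∀ ω ∈ Icc x P, HasDerivWithinAt (orbitCurve a b η q ζ)
      ((ζ ω / (η * (ζ ω + α * η))) • scalingField a b α (orbitCurve a b η q ζ ω)) (Icc x P) ω := by
    intro ω hω
    have h1 := hζ1 ω hω
    refine (hasDerivAt_orbitCurve hη (by linarith) (by linarith) (by linarith) ?_).hasDerivWithinAt
    have := (hasDerivAt_radius hk (hr0 ω hω)).comp ω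
      (hr.hasDerivAt ω ⟨hMx.trans hω.1, hω.2.trans hPM⟩)
    rw [hG _ (hr0 ω hω)] at this
    refine this.congr_deriv ?_
    rw [one_div_mul_eq_div]
  obtain ⟨T, hT, φ, hφ0, hφT, hφ, hφ'⟩ := exists_time_change
    (ρ := fun ω => ζ ω / (η * (ζ ω + α * η))) (m := 1 / (2 * η)) hxP
    (hζc.continuousOn.div (by fun_prop) fun ω hω => by
      have := hζ1 ω hω
      exact (mul_pos hη (by linarith)).ne')
    (by positivity)
    (fun ω hω => by
      have := hζ1 ω hω
      rw [div_le_div_iff₀ (by positivity) (mul_pos hη (by linarith))]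
      nlinarith)
    hcurve
  refine ⟨hxS, hPS, T, hT, fun t => orbitCurve a b η q ζ (φ t), ?_, ?_, fun t ht => ⟨?_, (hφ t ht).2⟩,
    fun t ht hmem => ?_⟩
  · simp only [hφ0, hend x hr.init]
  · simp only [hφT, hend P hrP]
  · have hω := (hφ t ht).1
    have h1 := hζ1 _ hω
    have h0 : 0 < ζ (φ t) := by linarith
    refine hW _ ⟨?_, ?_⟩ _ ⟨by positivity, div_le_self hη.le h1⟩ _ ⟨?_, ?_⟩
    · rw [le_div_iff₀ h0]
      nlinarith [hω.1]
    · rw [div_le_iff₀ h0]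
      nlinarith [hω.2]
    · exact div_nonneg (profile_pos hl hq h1).le h0.le
    · exact (div_le_self (profile_pos hl hq h1).le h1).trans (profile_le hl hq hm h1)
  -- Between the zeros of `r`, `z > 1` while `z q₂ ≤ q`, so `q₂ < q` and the orbit is off the face.
  · have h1 : 1 < ζ (φ t) := one_lt_radius (hpos _ (hφ' t ht))
    have h2 := hS _ hmem
    have h3 := profile_le hl hq hm h1.le
    simp only [orbitCurve] at h2
    rw [div_eq_iff (by linarith)] at h2
    nlinarith

/-! ### The height at which `Q₂` meets the face -/

section FlatFun

variable {a b : ℝ}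

theorem continuousOn_flatFun : ContinuousOn (flatFun a b) (Ioi 0) := by
  have : ContinuousOn (fun y => (1 + a * y) * Real.exp (-(y⁻¹ * b))) (Ioi 0) := by
    have : ContinuousOn (fun y : ℝ => y⁻¹) (Ioi 0) :=
      continuousOn_inv₀.mono fun y (hy : 0 < y) => hy.ne'
    fun_prop
  exact this.congr fun y (hy : 0 < y) => by rw [flatFun, if_neg hy.ne']

theorem flatFun_pos {y : ℝ} (hy : 0 < y) (h : 0 < 1 + a * y) : 0 < flatFun a b y := by
  rw [flatFun, if_neg hy.ne']
  positivity

/-- With `z = y' / y`, `profile_le` based at `y'` says `z * flatFun a b y ≤ flatFun a b y'`;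
strictness comes from `z > 1`. -/
theorem flatFun_lt {y y' : ℝ} (hy : 0 < y) (hyy : y < y') (ha : |a| * y' ≤ 1 / 2)
    (hb : 2 * y' ≤ b) : flatFun a b y < flatFun a b y' := by
  have hy' : 0 < y' := hy.trans hyy
  have hl : |a * y'| ≤ 1 / 2 := by rwa [abs_mul, abs_of_pos hy']
  have hl1 := (abs_le.1 hl).1
  have hq : 0 < flatFun a b y' := flatFun_pos hy' (by linarith)
  have hz : 1 < y' / y := by rwa [one_lt_div hy]
  have h1 := profile_le hl hq (show 2 ≤ b / y' by rwa [le_div_iff₀ hy']) hz.le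
  have he : profile (a * y') (b / y') (flatFun a b y') (y' / y) = flatFun a b y * (y' / y) := by
    rw [profile, flatFun, flatFun, if_neg hy.ne', if_neg hy'.ne',
      show -(y⁻¹ * b) = -(y'⁻¹ * b) + -(b / y' * (y' / y - 1)) by field_simp; ring, Real.exp_add]
    have : 1 + a * y' ≠ 0 := by linarith
    field_simp
  rw [he] at h1
  refine lt_of_lt_of_le (lt_mul_of_one_lt_right (flatFun_pos hy ?_) hz) h1
  nlinarith [neg_abs_le a, abs_nonneg a]

theorem one_add_mul_pos {χ y : ℝ} (h : 0 < 1 + a * χ) (hy : 0 ≤ y) (hyχ : y ≤ χ) :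
    0 < 1 + a * y := by
  rcases le_total 0 a with ha | ha
  · positivity
  · nlinarith

/-- For small `ε` the surface `Q₂` meets the face `q₂ = μ⁻¹` at exactly one small height. -/
theorem exists_height (hb : 0 < b) {χ η μ : ℝ} (hχ : 0 < 1 + a * χ) (hη : 0 < η) (hηχ : η ≤ χ)
    (haη : |a| * η ≤ 1 / 2) (hbη : 2 * η ≤ b) (hμ : 0 < μ) :
    ∃ ε₀ > 0, ∀ ε ∈ Ioo 0 ε₀, ∃ y₀ ∈ Ioo 0 η, ∀ y ∈ Icc 0 χ,
      (Real.sqrt ε * μ⁻¹ = flatFun a b y ↔ y = y₀) := by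
  obtain ⟨z, hz, hmin⟩ := isCompact_Icc.exists_isMinOn (nonempty_Icc.2 hηχ)
    ((continuousOn_flatFun (a := a) (b := b)).mono fun y (hy : y ∈ Icc η χ) => hη.trans_le hy.1)
  have hz0 : 0 < z := hη.trans_le hz.1
  have hpos : 0 < flatFun a b z := flatFun_pos hz0 (one_add_mul_pos hχ hz0.le hz.2)
  refine ⟨(flatFun a b z * μ) ^ 2, by positivity, fun ε hε => ?_⟩
  set t := Real.sqrt ε * μ⁻¹ with ht
  have ht0 : 0 < t := mul_pos (Real.sqrt_pos.2 hε.1) (inv_pos.2 hμ)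
  have htz : t < flatFun a b z := by
    rw [ht, ← div_eq_mul_inv, div_lt_iff₀ hμ]
    exact (Real.sqrt_lt' (by positivity)).2 hε.2
  have hlarge : ∀ y ∈ Icc η χ, t < flatFun a b y := fun y hy => htz.trans_le (hmin hy)
  -- From `e^s ≥ s` one gets `e^{-b/y₁} ≤ y₁ / b ≤ t / 2`, and `1 + a y₁ ≤ 2`.
  set y₁ := min (t * b / 2) η with hy₁
  have hy₁0 : 0 < y₁ := lt_min (by positivity) hη
  have hy₁t : y₁ ≤ t * b / 2 := min_le_left _ _
  have hsmall : flatFun a b y₁ ≤ t := by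
    have h1 : 1 + a * y₁ ≤ 2 := by
      nlinarith [le_abs_self a, abs_nonneg a, min_le_right (t * b / 2) η]
    have h2 : Real.exp (-(y₁⁻¹ * b)) ≤ t / 2 := by
      rw [Real.exp_neg]
      refine inv_le_of_inv_le₀ (by positivity) (le_trans ?_ ((Real.add_one_le_exp _).trans' <|
        le_add_of_nonneg_right zero_le_one))
      rw [inv_mul_eq_div, le_div_iff₀ hy₁0, inv_mul_le_iff₀ (by positivity)]
      linarith
    rw [flatFun, if_neg hy₁0.ne']
    have h3 := Real.exp_pos (-(y₁⁻¹ * b))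
    nlinarith
  obtain ⟨y₀, hy₀, hy₀t⟩ := intermediate_value_Icc (min_le_right (t * b / 2) η)
    ((continuousOn_flatFun (a := a) (b := b)).mono fun y hy => hy₁0.trans_le hy.1)
    ⟨hsmall, (hlarge η ⟨le_rfl, hηχ⟩).le⟩
  have hlt : y₀ < η := lt_of_le_of_ne hy₀.2 fun h => by
    rw [h] at hy₀t
    exact (hlarge η ⟨le_rfl, hηχ⟩).ne' hy₀t
  have hy₀0 : 0 < y₀ := hy₁0.trans_le hy₀.1
  refine ⟨y₀, ⟨hy₀0, hlt⟩, fun y hy => ⟨fun h => ?_, fun h => by rw [h, hy₀t]⟩⟩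
  have hyη : y < η := by
    by_contra! h'
    exact (hlarge y ⟨h', hy.2⟩).ne h
  have hy0 : 0 < y := lt_of_le_of_ne hy.1 fun h' => by
    rw [← h', flatFun, if_pos rfl] at h
    exact ht0.ne' h
  have hmono : ∀ {u v}, 0 < u → u < v → v < η → flatFun a b u < flatFun a b v :=
    fun {u v} hu huv hv => flatFun_lt hu huv
      ((mul_le_mul_of_nonneg_left hv.le (abs_nonneg a)).trans haη) (by linarith)
  rcases lt_trichotomy y y₀ with h' | h' | h'
  · have := hmono hy0 h' hlt
    linarith
  · exact h'
  · have := hmono hy₀0 h' hyη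
    linarith

end FlatFun

/-! ### Choice of small parameters and the theorem -/

theorem eventually_mul_le (c : ℝ) {d : ℝ} (hd : 0 < d) : ∀ᶠ s in 𝓝[>] (0 : ℝ), c * s ≤ d := by
  have h : Tendsto (fun s : ℝ => c * s) (𝓝[>] 0) (𝓝 0) := by
    have : Continuous fun s : ℝ => c * s := by fun_prop
    simpa using (this.tendsto 0).mono_left nhdsWithin_le_nhds
  exact (h.eventually_lt_const hd).mono fun s hs => hs.le

theorem eventually_mul_exp_le {b q σ : ℝ} (hb : 0 < b) (hσ : 0 < σ) :
    ∀ᶠ η in 𝓝[>] (0 : ℝ),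
      2 * (q * (2 + b / η)) * Real.exp (-((b / η - 2) * (σ / 4))) ≤ σ := by
  have h1 : Tendsto (fun η : ℝ => b / η) (𝓝[>] 0) atTop := by
    simpa only [div_eq_mul_inv] using tendsto_inv_nhdsGT_zero.const_mul_atTop hb
  have hs : 0 < σ / 4 := by positivity
  have h2 : Tendsto (fun m : ℝ => 2 * (q * (2 + m)) * Real.exp (-((m - 2) * (σ / 4)))) atTop
      (𝓝 0) := by
    have ha := tendsto_rpow_mul_exp_neg_mul_atTop_nhds_zero 1 (σ / 4) hs
    have hb := tendsto_rpow_mul_exp_neg_mul_atTop_nhds_zero 0 (σ / 4) hs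
    have := ((hb.const_mul 2).add ha).const_mul (2 * q * Real.exp (2 * (σ / 4)))
    simp only [Real.rpow_one, Real.rpow_zero, mul_zero, add_zero] at this
    refine this.congr fun m => ?_
    rw [show -((m - 2) * (σ / 4)) = 2 * (σ / 4) + -(σ / 4) * m by ring, Real.exp_add]
    ring
  exact ((h2.comp h1).eventually_lt_const hσ).mono fun s hs => hs.le

theorem lemma4p3 (a b : ℝ) (hb : 0 < b) (ν : ℝ) (hν : 0 < ν) :
    ∃ μ₀ : ℝ, 0 < μ₀ ∧ ∀ μ : ℝ, μ₀ ≤ μ →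
      ∀ ξ : ℝ, 0 < ξ → ∀ χ : ℝ, 0 < χ → 0 < 1 + a * χ → ∀ A : ℝ,
        ∃ ε₀ : ℝ, 0 < ε₀ ∧ ∃ (y : ℝ → ℝ) (P D : ℝ → ℝ → ℝ → ℝ),
          (∀ ε ∈ Ioo 0 ε₀,
            Γ₂ ξ χ μ ∩ Q₂ a b ε =
              {p | p.1 ∈ Icc (-ξ⁻¹) ξ⁻¹ ∧ p.2.1 = y ε ∧ p.2.2 = μ⁻¹}) ∧
          (∀ ε ∈ Ioo 0 ε₀, ∀ α : ℝ, |α| ≤ A → ∀ x ∈ Icc (-ξ⁻¹) (-ν),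
            IsFirstReturn (scalingField a b α) (slab χ μ) (slabFace χ μ ∩ Q₂ a b ε)
              (x, y ε, μ⁻¹) (P ε α x, y ε, μ⁻¹) ∧
            HasDerivWithinAt (P ε α) (D ε α x) (Icc (-ξ⁻¹) (-ν)) x) ∧
          (∀ δ : ℝ, 0 < δ → ∃ ε₁ ∈ Ioc 0 ε₀, ∀ ε ∈ Ioo 0 ε₁, ∀ α : ℝ, |α| ≤ A →
            ∀ x ∈ Icc (-ξ⁻¹) (-ν),
              |P ε α x - (-x)| ≤ δ ∧ |D ε α x - (-1)| ≤ δ ∧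
              (-ξ⁻¹ + δ ≤ x →
                IsFirstReturn (scalingField a b α) (U₂ ξ χ μ) (Γ₂ ξ χ μ ∩ Q₂ a b ε)
                  (x, y ε, μ⁻¹) (P ε α x, y ε, μ⁻¹))) := by
  -- This gives `q ≤ ν/2`, leaving `ν/4` for the extension of the forcing below the bound `3ν/4`.
  refine ⟨2 / ν, by positivity, fun μ hμν ξ hξ χ hχ haχ A => ?_⟩
  have hμ : 0 < μ := lt_of_lt_of_le (by positivity) hμν
  set q := μ⁻¹ with hq
  have hq0 : 0 < q := inv_pos.2 hμ
  have hqν : 2 * q ≤ ν := by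
    rw [hq, ← div_eq_mul_inv, div_le_iff₀ hμ]
    rwa [div_le_iff₀ hν, mul_comm] at hμν
  set N := ξ⁻¹ with hN
  have hN0 : 0 < N := inv_pos.2 hξ
  -- the range of admissible heights
  obtain ⟨η₁, ⟨hη₁χ, hη₁A, hη₁a, hη₁b⟩, hη₁⟩ :=
    (((eventually_mul_le 1 hχ).and <| (eventually_mul_le |A| (show (0 : ℝ) < 1 / 4 by norm_num)).and
      <| (eventually_mul_le |a| (show (0 : ℝ) < 1 / 2 by norm_num)).and
      (eventually_mul_le 2 hb)).and self_mem_nhdsWithin).exists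
  rw [one_mul] at hη₁χ
  have hη₁0 : 0 < η₁ := hη₁
  obtain ⟨ε₀, hε₀, hheight⟩ := exists_height hb haχ hη₁0 hη₁χ hη₁a hη₁b hμ
  have hy : ∀ ε, ∃ y₀, ε ∈ Ioo 0 ε₀ → y₀ ∈ Ioo 0 η₁ ∧ ∀ y ∈ Icc 0 χ,
      (Real.sqrt ε * q = flatFun a b y ↔ y = y₀) := fun ε => by
    by_cases hε : ε ∈ Ioo 0 ε₀
    · obtain ⟨y₀, h⟩ := hheight ε hε
      exact ⟨y₀, fun _ => h⟩
    · exact ⟨0, fun h => absurd h hε⟩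
  choose y hy using hy
  have hk : ∀ ε ∈ Ioo 0 ε₀, ∀ α, |α| ≤ A → |α * y ε| ≤ 1 / 4 := fun ε hε α hα => by
    have h := (hy ε hε).1
    rw [abs_mul, abs_of_pos h.1]
    exact (mul_le_mul (hα.trans (le_abs_self A)) h.2.le h.1.le (abs_nonneg A)).trans hη₁A
  have hl : ∀ ε ∈ Ioo 0 ε₀, |a * y ε| ≤ 1 / 2 := fun ε hε => by
    have h := (hy ε hε).1
    rw [abs_mul, abs_of_pos h.1]
    exact (mul_le_mul_of_nonneg_left h.2.le (abs_nonneg a)).trans hη₁a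
  have hm : ∀ ε ∈ Ioo 0 ε₀, 2 ≤ b / y ε := fun ε hε => by
    have h := (hy ε hε).1
    rw [le_div_iff₀ h.1]
    linarith [h.2]
  have hforce : ∀ ε α, ∃ G g : ℝ → ℝ, ε ∈ Ioo 0 ε₀ → |α| ≤ A →
      IsForcing G g (2 * (q * (2 + b / y ε))) ν ∧
      (∀ r, 0 ≤ r → G r = profile (a * y ε) (b / y ε) q (radius (α * y ε) r)) ∧
      ∀ σ, 0 < σ → σ ≤ 1 →
        2 * (q * (2 + b / y ε)) * Real.exp (-((b / y ε - 2) * (σ / 4))) ≤ σ →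
        (∀ ρ, σ ≤ ρ → G ρ ≤ σ) ∧ ∀ ρ, σ ≤ ρ → |g ρ| ≤ σ := by
    intro ε α
    by_cases h : ε ∈ Ioo 0 ε₀ ∧ |α| ≤ A
    · obtain ⟨G, g, hG⟩ := exists_isForcing_profile (hk ε h.1 α h.2) (hl ε h.1) (hm ε h.1) hq0 hqν
      exact ⟨G, g, fun _ _ => hG⟩
    · exact ⟨0, 0, fun h1 h2 => absurd ⟨h1, h2⟩ h⟩
  choose G g hG using hforce
  set κ := 4 / ν * (3 + 2 * N) with hκ
  set C := κ * (1 / ν + 40 * N / ν ^ 2) + 2 * ν + 4 / ν with hC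
  have hreturn : ∀ ε α, ∃ (R : ℝ → ℝ → ℝ) (P D : ℝ → ℝ), ε ∈ Ioo 0 ε₀ → |α| ≤ A →
      ∀ x ∈ Icc (-N) (-ν), IsArc (G ε α) (7 * N) x (R x) ∧ P x ∈ Icc (-x) (7 * N) ∧
      R x (P x) = 0 ∧ (∀ ω ∈ Ioo x (P x), 0 < R x ω) ∧
      HasDerivWithinAt P (D x) (Icc (-N) (-ν)) x ∧
      ∀ σ, 0 < σ → 16 * σ ≤ ν ^ 2 → 4 * σ ≤ ν → C * σ ≤ 1 →
        (∀ ρ, σ ≤ ρ → G ε α ρ ≤ σ) → (∀ ρ, σ ≤ ρ → |g ε α ρ| ≤ σ) →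
        |P x - -x| ≤ κ * σ ∧ |D x - -1| ≤ 2 * (C * σ) := by
    intro ε α
    by_cases h : ε ∈ Ioo 0 ε₀ ∧ |α| ≤ A
    · obtain ⟨R, P, D, hR⟩ := exists_return_map (N := N) (hG ε α h.1 h.2).1 hν
      exact ⟨R, P, D, fun _ _ => hR⟩
    · exact ⟨0, 0, 0, fun h1 h2 => absurd ⟨h1, h2⟩ h⟩
  choose R P D hR using hreturn
  have hmemQ : ∀ ε ∈ Ioo 0 ε₀, ∀ X, (X, y ε, q) ∈ Q₂ a b ε := fun ε hε X => by
    have h := hy ε hε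
    exact (h.2 (y ε) ⟨h.1.1.le, h.1.2.le.trans hη₁χ⟩).2 rfl
  have hfirst : ∀ ε ∈ Ioo 0 ε₀, ∀ α, |α| ≤ A → ∀ x ∈ Icc (-N) (-ν), ∀ W S : Set (ℝ × ℝ × ℝ),
      (∀ X ∈ Icc x (P ε α x), ∀ Y ∈ Icc 0 χ, ∀ Z ∈ Icc 0 q, (X, Y, Z) ∈ W) →
      (∀ p ∈ S, p.2.2 = q) → (x, y ε, q) ∈ S → (P ε α x, y ε, q) ∈ S →
      IsFirstReturn (scalingField a b α) W S (x, y ε, q) (P ε α x, y ε, q) := by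
    intro ε hε α hα x hx W S hW hS hxS hPS
    obtain ⟨hr, hP, hrP, hpos, -⟩ := hR ε α hε hα x hx
    have hyε := (hy ε hε).1
    exact hr.isFirstReturn hyε.1 hq0 (hk ε hε α hα) (hl ε hε) (hm ε hε) (hG ε α hε hα).2.1
      (by linarith [hx.1]) hP.2 (by linarith [hx.2]) (by linarith [hx.2, hP.1]) hrP hpos
      (fun X hX Y hY Z hZ => hW X hX Y ⟨hY.1, hY.2.trans (hyε.2.le.trans hη₁χ)⟩ Z hZ) hS hxS hPS
  refine ⟨ε₀, hε₀, y, P, D, fun ε hε => ?_, fun ε hε α hα x hx => ⟨?_, ?_⟩, fun δ hδ => ?_⟩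
  · obtain ⟨hyε, hyu⟩ := hy ε hε
    ext ⟨X, Y, Z⟩
    constructor
    · rintro ⟨⟨⟨hX, hY, -⟩, hZ⟩, hQ⟩
      have hZ' : Z = q := hZ
      refine ⟨hX, (hyu Y hY).1 ?_, hZ⟩
      rw [← hZ']
      exact hQ
    · rintro ⟨hX, hY, hZ⟩
      simp only at hX hY hZ
      subst hY hZ
      exact ⟨⟨⟨hX, ⟨hyε.1.le, hyε.2.le.trans hη₁χ⟩, hq0.le, le_rfl⟩, rfl⟩, hmemQ ε hε X⟩
  · have hyε := (hy ε hε).1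
    have hface : ∀ X, (X, y ε, q) ∈ slabFace χ μ ∩ Q₂ a b ε := fun X =>
      ⟨⟨⟨⟨hyε.1.le, hyε.2.le.trans hη₁χ⟩, hq0.le, le_rfl⟩, rfl⟩, hmemQ ε hε X⟩
    exact hfirst ε hε α hα x hx _ _ (fun X _ Y hY Z hZ => ⟨hY, hZ⟩) (fun p hp => hp.1.2)
      (hface _) (hface _)
  · exact (hR ε α hε hα x hx).2.2.2.2.1
  · obtain ⟨σ, ⟨hσ1, hσν, hσν', hσC, hσδ, hσδ'⟩, hσ0⟩ :=
      (((eventually_mul_le 1 one_pos).and <| (eventually_mul_le 16 (pow_pos hν 2)).and <|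
        (eventually_mul_le 4 hν).and <| (eventually_mul_le C one_pos).and <|
        (eventually_mul_le κ hδ).and (eventually_mul_le (2 * C) hδ)).and
        self_mem_nhdsWithin).exists
    rw [one_mul] at hσ1
    obtain ⟨η₂, hη₂, hη₂s⟩ := mem_nhdsGT_iff_exists_Ioo_subset.1
      (eventually_mul_exp_le (q := q) hb (show 0 < σ from hσ0))
    have hη₃0 : 0 < min η₁ η₂ := lt_min hη₁0 hη₂
    obtain ⟨ε₂, hε₂, hheight₂⟩ := exists_height hb haχ hη₃0 ((min_le_left _ _).trans hη₁χ)
      ((mul_le_mul_of_nonneg_left (min_le_left _ _) (abs_nonneg a)).trans hη₁a)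
      (by linarith [min_le_left η₁ η₂]) hμ
    refine ⟨min ε₀ ε₂, ⟨lt_min hε₀ hε₂, min_le_left _ _⟩, fun ε hε' α hα x hx => ?_⟩
    have hε : ε ∈ Ioo 0 ε₀ := ⟨hε'.1, hε'.2.trans_le (min_le_left _ _)⟩
    obtain ⟨hyε, hyu⟩ := hy ε hε
    obtain ⟨y₂, hy₂, hyu₂⟩ := hheight₂ ε ⟨hε'.1, hε'.2.trans_le (min_le_right _ _)⟩
    -- Uniqueness of the height on `[0, χ]` transfers the smaller bound `η₂` to `y ε`.
    have hyy : y ε = y₂ := (hyu₂ (y ε) ⟨hyε.1.le, hyε.2.le.trans hη₁χ⟩).1 (hmemQ ε hε 0)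
    have hsmall := hη₂s (show y ε ∈ Ioo 0 η₂ from
      ⟨hyε.1, by rw [hyy]; exact hy₂.2.trans_le (min_le_right _ _)⟩)
    obtain ⟨hGσ, hgσ⟩ := (hG ε α hε hα).2.2 σ hσ0 hσ1 hsmall
    obtain ⟨-, hP, -, -, -, hest⟩ := hR ε α hε hα x hx
    obtain ⟨hPδ, hDδ⟩ := hest σ hσ0 hσν hσν' hσC hGσ hgσ
    have hPδ' := hPδ.trans hσδ
    refine ⟨hPδ', hDδ.trans (by linarith), fun hxδ => ?_⟩
    have hPN : P ε α x ≤ N := by linarith [(abs_le.1 hPδ').2]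
    have hface : ∀ X ∈ Icc (-N) N, (X, y ε, q) ∈ Γ₂ ξ χ μ ∩ Q₂ a b ε := fun X hX =>
      ⟨⟨⟨hX, ⟨hyε.1.le, hyε.2.le.trans hη₁χ⟩, hq0.le, le_rfl⟩, rfl⟩, hmemQ ε hε X⟩
    exact hfirst ε hε α hα x hx _ _
      (fun X hX Y hY Z hZ => ⟨⟨hx.1.trans hX.1, hX.2.trans hPN⟩, hY, hZ⟩) (fun p hp => hp.1.2)
      (hface _ ⟨hx.1, by linarith [hx.2]⟩) (hface _ ⟨by linarith [hx.2, hP.1], hPN⟩)
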